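/- For an integral domain $R$, let the Golomb space $G(R)$ be the set $R\setminus\{0\}$ of nonzero elements of $R$, endowed with the topology generated by the coprime cosets, that is, by the sets $(a+I)\setminus\{0\}$, where $a\in R$ and $I$ is a nonzero ideal of $R$ such that the ideal $\langle a,I\rangle$ generated by $a$ and $I$ is $R$. Theorem. The self-homeomorphisms of $G(\mathbb{Z})$ are exactly the identity and the multiplication by $-1$: a map $h\colon G(\mathbb{Z})\to G(\mathbb{Z})$ is a homeomorphism if and only if either $h(n)=n$ for all $n\in\mathbb{Z}\setminus\{0\}$, or $h(n)=-n$ for all $n\in\mathbb{Z}\setminus\{0\}$. -/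

import Mathlib

/-- The underlying set of the Golomb space `G(R)`: the nonzero elements of `R`.
This is a type of its own, so that it does not inherit the subspace topology of `R`. -/
structure GolombSpace (R : Type*) [CommRing R] where
  /-- The element of the ring. -/
  val : R
  /-- It is nonzero. -/
  ne_zero : val ≠ 0

namespace GolombSpace

/-- A coprime coset of `R`: a coset `a + I`, where `I` is a nonzero ideal and `⟨a, I⟩ = R`, viewed
as a set of nonzero elements of `R`. (If `I ≠ R`, then `0 ∉ a + I` automatically; for `I = R` one
gets the set of all the nonzero elements.) -/
def IsCoprimeCoset {R : Type*} [CommRing R] (U : Set (GolombSpace R)) : Prop :=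
  ∃ (a : R) (I : Ideal R), I ≠ ⊥ ∧ Ideal.span {a} ⊔ I = ⊤ ∧
    U = {x : GolombSpace R | x.val - a ∈ I}

/-- The Golomb topology: the topology generated by the coprime cosets. -/
instance instTopologicalSpace (R : Type*) [CommRing R] : TopologicalSpace (GolombSpace R) :=
  TopologicalSpace.generateFrom {U | IsCoprimeCoset U}

end GolombSpace

/-!
The basic neighbourhoods of a point `x` of `G(ℤ)` are the residue classes `x + Nℤ`, with `N` prime
to `x`. The proof recovers arithmetic from this topology, until nothing but a sign is free.

*Prime divisors.* The closure of `x + Nℤ` contains every point divisible by all primes dividing `N`;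
at a prime `p ∤ N` it imposes no condition, and at a prime power `p ^ k ∣ N` a limit point prime to
`p` must be congruent to `x` modulo `p ^ k`. By comparing the intersections of closures of
neighbourhoods of two points (`ClosureFiner`), one sees topologically that `{1, -1}` is a special
pair, and which sets of prime divisors are contained in each other. So, after a composition with
`x ↦ -x`, a homeomorphism `h` fixes `1`, and it induces a permutation `σ` of the primes such that
`p ∣ x` if and only if `σ p ∣ h x`. Moreover the `p`-adic topology on the integers prime to `p` is
generated by the traces of closed-open sets (`exists_pow_residueClass_subset`), so `h` carries it to
the `σ p`-adic topology. The structure `IsGolombMap` collects what the rest of the proof uses.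

*Powers.* For a prime `z`, the numbers `± z ^ n` are those with no other prime divisors than `z`;
so they are mapped to the numbers `± σ z ^ n`. Approximating an arbitrary `x` by primes `z`, with
Dirichlet's theorem, one finds that `h` maps powers of `x` to powers of `h x`, up to sign
(`exists_natAbs_symm_eq_pow`). Hence `h r = ± σ r` for primes `r`, and `h (r ^ n) = ± σ r ^ f n`,
where `f` is an automorphism of the positive integers ordered by divisibility; thus
`f (l ^ j) = f l ^ j`, with `f l` prime, for primes `l`.

*The permutation is trivial.* The map `h` respects limits of powers in the `p`-adic topologies, so
`f` matches the prime powers that divide orders modulo powers of `p` with those that divide orders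
modulo powers of `σ p` (`exists_pow_dvd_orderSq`). All powers of `p`, and of no other prime, divide
such orders, which gives `f p = σ p`. If `r` is a primitive root modulo `p`, one obtains that
`l ^ j ∣ p / 2` implies `σ l ^ j ∣ σ p / 2` (`pow_dvd_half`). As the same holds for the inverse, `σ`
permutes `{2, 3}`; it cannot interchange them, since it would map `11` to `15`; and then `σ p = p`
by induction.

*The sign.* Now `h r = ± r` for primes, and `h x = ± x` in general by Dirichlet's theorem. The sign
is `p`-adically locally constant for every odd prime `p`, so it is constant by the Chinese
remainder theorem.
-/

/-! ### Integer preliminaries -/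

/-- Two integers are coprime as soon as no prime number divides both. -/
theorem Int.isCoprime_of_forall_prime {a b : ℤ}
    (h : ∀ p : ℕ, p.Prime → (p : ℤ) ∣ a → ¬ (p : ℤ) ∣ b) : IsCoprime a b := by
  rw [Int.isCoprime_iff_gcd_eq_one]
  by_contra hne
  obtain ⟨p, hp, hpd⟩ := Nat.exists_prime_and_dvd hne
  exact h p hp ((Int.natCast_dvd_natCast.2 hpd).trans (Int.gcd_dvd_left ..))
    ((Int.natCast_dvd_natCast.2 hpd).trans (Int.gcd_dvd_right ..))

theorem Int.not_dvd_of_isCoprime {a b : ℤ} (h : IsCoprime a b) {p : ℕ} (hp : p.Prime)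
    (ha : (p : ℤ) ∣ a) : ¬ (p : ℤ) ∣ b := fun hb =>
  (Nat.prime_iff_prime_int.1 hp).not_isUnit (h.isUnit_of_dvd' ha hb)

/-- The Chinese remainder theorem for two moduli. -/
theorem Int.exists_dvd_sub_and_dvd_sub {a b : ℤ} (h : IsCoprime a b) (s t : ℤ) :
    ∃ z : ℤ, a ∣ z - s ∧ b ∣ z - t := by
  obtain ⟨u, v, huv⟩ := h
  refine ⟨s + (t - s) * (u * a), ⟨(t - s) * u, by ring⟩, ⟨(s - t) * v, ?_⟩⟩
  linear_combination (t - s) * huv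

theorem Int.dvd_of_forall_prime_pow_dvd {a b : ℤ}
    (h : ∀ p : ℕ, p.Prime → ∀ k : ℕ, (p : ℤ) ^ k ∣ a → (p : ℤ) ^ k ∣ b) : a ∣ b := by
  rw [← Int.natAbs_dvd_natAbs, Nat.dvd_iff_prime_pow_dvd_dvd]
  intro p k hp hk
  have := h p hp k (by exact_mod_cast Int.natCast_dvd.2 hk)
  exact Int.natCast_dvd.1 (by exact_mod_cast this)

theorem Int.exists_eq_prime_pow_mul {p : ℕ} (hp : p.Prime) {N : ℤ} (hN : N ≠ 0) :
    ∃ (e : ℕ) (M : ℤ), N = (p : ℤ) ^ e * M ∧ ¬ (p : ℤ) ∣ M := by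
  have hf : FiniteMultiplicity (p : ℤ) N :=
    Int.finiteMultiplicity_iff.2 ⟨by simpa using hp.ne_one, hN⟩
  obtain ⟨c, hc, hd⟩ := hf.exists_eq_pow_mul_and_not_dvd
  exact ⟨_, c, hc, hd⟩

theorem Int.isCoprime_prime_pow {p : ℕ} (hp : p.Prime) {M : ℤ} (h : ¬ (p : ℤ) ∣ M) (e : ℕ) :
    IsCoprime ((p : ℤ) ^ e) M :=
  ((Nat.prime_iff_prime_int.1 hp).coprime_iff_not_dvd.2 h).pow_left

theorem Int.isCoprime_prime_pow_iff {p : ℕ} (hp : p.Prime) {M : ℤ} {e : ℕ} (he : e ≠ 0) :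
    IsCoprime M ((p : ℤ) ^ e) ↔ ¬ (p : ℤ) ∣ M := by
  rw [IsCoprime.pow_right_iff (Nat.pos_of_ne_zero he), isCoprime_comm,
    (Nat.prime_iff_prime_int.1 hp).coprime_iff_not_dvd]

/-- A prime power dividing `p ^ e * M` divides `p ^ e`, if the prime does not divide `M`. -/
theorem Int.prime_pow_dvd_left {q : ℕ} (hq : q.Prime) {k : ℕ} {a M : ℤ}
    (h : (q : ℤ) ^ k ∣ a * M) (hM : ¬ (q : ℤ) ∣ M) : (q : ℤ) ^ k ∣ a :=
  (Int.isCoprime_prime_pow hq hM k).dvd_of_dvd_mul_right h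

theorem Int.exists_odd_prime_not_dvd {x : ℤ} (hx : x ≠ 0) (n : ℕ) :
    ∃ p : ℕ, p.Prime ∧ p ≠ 2 ∧ p ≠ n ∧ ¬ (p : ℤ) ∣ x := by
  obtain ⟨p, hp1, hp⟩ := Nat.exists_infinite_primes (x.natAbs + n + 3)
  refine ⟨p, hp, by omega, by omega, fun h => ?_⟩
  have := Nat.le_of_dvd (Int.natAbs_pos.2 hx) (Int.natCast_dvd.1 h)
  omega

/-- For every prime not dividing `y`, its full power dividing `K` still divides some `L`
coprime to `y`. -/
theorem Int.exists_coprime_part {K : ℤ} (hK : K ≠ 0) (y : ℤ) :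
    ∃ L : ℤ, L ≠ 0 ∧ IsCoprime y L ∧
      ∀ p : ℕ, p.Prime → ¬ (p : ℤ) ∣ y → ∀ k : ℕ, (p : ℤ) ^ k ∣ K → (p : ℤ) ^ k ∣ L := by
  suffices H : ∀ n : ℕ, n ≠ 0 → ∃ L : ℤ, L ≠ 0 ∧ IsCoprime y L ∧
      ∀ p : ℕ, p.Prime → ¬ (p : ℤ) ∣ y → ∀ k : ℕ, (p : ℤ) ^ k ∣ (n : ℤ) → (p : ℤ) ^ k ∣ L by
    obtain ⟨L, h1, h2, h3⟩ := H K.natAbs (by simpa using hK)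
    exact ⟨L, h1, h2, fun p hp hpy k hk => h3 p hp hpy k (Int.dvd_natAbs.2 hk)⟩
  intro n
  induction n using induction_on_primes with
  | zero => simp
  | one => exact fun _ => ⟨1, one_ne_zero, isCoprime_one_right, fun p _ _ k hk => by simpa using hk⟩
  | prime_mul q a hq ih =>
    intro hqa
    obtain ⟨L, h1, h2, h3⟩ := ih (right_ne_zero_of_mul hqa)
    have hq' : ((q : ℕ) : ℤ) ≠ 0 := by exact_mod_cast hq.ne_zero
    have key : ∀ p : ℕ, p.Prime → p ≠ q → ¬ (p : ℤ) ∣ (q : ℤ) := fun p hp hpq h =>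
      hpq ((Nat.prime_dvd_prime_iff_eq hp hq).1 (by exact_mod_cast h))
    by_cases hqy : (q : ℤ) ∣ y
    · refine ⟨L, h1, h2, fun p hp hpy k hk => h3 p hp hpy k ?_⟩
      have hpq : p ≠ q := by rintro rfl; exact hpy hqy
      push_cast at hk
      rw [mul_comm] at hk
      exact Int.prime_pow_dvd_left hp hk (key p hp hpq)
    · refine ⟨q * L, mul_ne_zero hq' h1, IsCoprime.mul_right ?_ h2, fun p hp hpy k hk => ?_⟩
      · exact ((Nat.prime_iff_prime_int.1 hq).coprime_iff_not_dvd.2 hqy).symm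
      push_cast at hk
      by_cases hpq : p = q
      · subst hpq
        cases k with
        | zero => simp
        | succ k =>
          rw [pow_succ'] at hk ⊢
          exact mul_dvd_mul_left _ (h3 p hp hpy k ((mul_dvd_mul_iff_left hq').1 hk))
      · rw [mul_comm] at hk
        exact (h3 p hp hpy k (Int.prime_pow_dvd_left hp hk (key p hp hpq))).mul_left _

/-! ### The topology of the Golomb space of the integers -/

namespace GolombSpace

/-- The residue class of `x` modulo `N`, as a set of nonzero integers. -/
def residueClass (x N : ℤ) : Set (GolombSpace ℤ) := {z | N ∣ z.val - x}

@[ext] theorem ext_val {R : Type*} [CommRing R] {x y : GolombSpace R} (h : x.val = y.val) :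
    x = y := by
  cases x; cases y; simpa using h

theorem isOpen_iff {U : Set (GolombSpace ℤ)} :
    IsOpen U ↔ ∀ x ∈ U, ∃ N : ℤ, N ≠ 0 ∧ IsCoprime x.val N ∧ residueClass x.val N ⊆ U := by
  constructor
  · intro hU
    induction hU with
    | basic U hU =>
      obtain ⟨a, I, hI, hsup, rfl⟩ := hU
      obtain ⟨N, rfl⟩ := (IsPrincipalIdealRing.principal I).principal
      simp only [Ideal.submodule_span_eq, Ne, Ideal.span_singleton_eq_bot] at hI hsup ⊢
      rw [← Ideal.isCoprime_iff_sup_eq, Ideal.isCoprime_span_singleton_iff] at hsup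
      intro x hx
      simp only [Set.mem_ofPred_eq, Ideal.mem_span_singleton] at hx
      refine ⟨N, hI, ?_, fun z hz => ?_⟩
      · obtain ⟨c, hc⟩ := hx
        rw [sub_eq_iff_eq_add'.1 hc]
        exact hsup.add_mul_left_left c
      · simp only [Set.mem_ofPred_eq, Ideal.mem_span_singleton]
        have := dvd_add (show N ∣ z.val - x.val from hz) hx
        simpa using this
    | univ => exact fun x _ => ⟨1, one_ne_zero, isCoprime_one_right, Set.subset_univ _⟩
    | inter U V _ _ ihU ihV =>
      rintro x ⟨hxU, hxV⟩
      obtain ⟨N, hN, hxN, hNU⟩ := ihU x hxU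
      obtain ⟨M, hM, hxM, hMV⟩ := ihV x hxV
      exact ⟨N * M, mul_ne_zero hN hM, hxN.mul_right hxM, fun z hz =>
        ⟨hNU ((dvd_mul_right N M).trans hz), hMV ((dvd_mul_left M N).trans hz)⟩⟩
    | sUnion S _ ih =>
      rintro x ⟨U, hUS, hxU⟩
      obtain ⟨N, hN, hxN, hNU⟩ := ih U hUS x hxU
      exact ⟨N, hN, hxN, hNU.trans (Set.subset_sUnion_of_mem hUS)⟩
  · intro h
    choose! N hN hxN hNU using h
    have : U = ⋃ x ∈ U, residueClass x.val (N x) := by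
      apply subset_antisymm
      · exact fun x hx => Set.mem_biUnion hx (by simp [residueClass])
      · exact Set.iUnion₂_subset hNU
    rw [this]
    refine isOpen_biUnion fun x hx => TopologicalSpace.isOpen_generateFrom_of_mem ?_
    refine ⟨x.val, Ideal.span {N x}, by simpa using hN x hx, ?_, ?_⟩
    · rw [← Ideal.isCoprime_iff_sup_eq, Ideal.isCoprime_span_singleton_iff]
      exact hxN x hx
    · ext z
      simp [residueClass, Ideal.mem_span_singleton]

theorem isOpen_residueClass {x N : ℤ} (hN : N ≠ 0) (h : IsCoprime x N) :
    IsOpen (residueClass x N) := by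
  refine isOpen_iff.2 fun y hy => ⟨N, hN, ?_, fun z hz => ?_⟩
  · obtain ⟨c, hc⟩ := hy
    rw [sub_eq_iff_eq_add'.1 hc]
    exact h.add_mul_left_left c
  · have := dvd_add (show N ∣ z.val - y.val from hz) hy
    simpa [residueClass] using this

theorem self_mem_residueClass (x : GolombSpace ℤ) (N : ℤ) : x ∈ residueClass x.val N := by
  simp [residueClass]

/-- The closure of a residue class modulo `N`: at each prime power `p ^ k ∣ N`, a limit point
either lies in the class modulo `p ^ k` or is divisible by `p`. -/
theorem mem_closure_residueClass {x N : ℤ} (hN : N ≠ 0) {z : GolombSpace ℤ} :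
    z ∈ closure (residueClass x N) ↔ ∀ p : ℕ, p.Prime → ¬ (p : ℤ) ∣ z.val →
      ∀ k : ℕ, (p : ℤ) ^ k ∣ N → (p : ℤ) ^ k ∣ z.val - x := by
  rw [mem_closure_iff]
  constructor
  · intro h p hp hpz k hk
    have hp0 : (p : ℤ) ^ k ≠ 0 := pow_ne_zero _ (by exact_mod_cast hp.ne_zero)
    obtain ⟨w, hw1, hw2⟩ := h _ (isOpen_residueClass hp0 (Int.isCoprime_prime_pow hp hpz k).symm)
      (self_mem_residueClass z _)
    have h1 : (p : ℤ) ^ k ∣ w.val - z.val := hw1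
    have h2 : (p : ℤ) ^ k ∣ w.val - x := hk.trans hw2
    simpa using dvd_sub h2 h1
  · intro h U hU hz
    obtain ⟨c, hc, hzc, hcU⟩ := isOpen_iff.1 hU z hz
    have hg : ((Int.gcd c N : ℕ) : ℤ) ∣ z.val - x := by
      apply Int.dvd_of_forall_prime_pow_dvd
      intro p hp k hk
      rcases Nat.eq_zero_or_pos k with rfl | hk0
      · simp
      refine h p hp ?_ k (hk.trans (Int.gcd_dvd_right ..))
      intro hpz
      exact Int.not_dvd_of_isCoprime hzc hp hpz
        ((dvd_pow_self _ hk0.ne').trans (hk.trans (Int.gcd_dvd_left ..)))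
    obtain ⟨d, hd⟩ := hg
    rw [Int.gcd_eq_gcd_ab] at hd
    -- Bézout gives a common element of the two classes; if it is `0`, shift it by `c * N`.
    obtain ⟨w, hw1, hw2⟩ : ∃ w : ℤ, c ∣ w - z.val ∧ N ∣ w - x :=
      ⟨z.val - c * (Int.gcdA c N * d), ⟨-(Int.gcdA c N * d), by ring⟩,
        ⟨Int.gcdB c N * d, by linear_combination hd⟩⟩
    by_cases hw : w = 0
    · refine ⟨⟨w + c * N, by simp [hw, hc, hN]⟩, hcU ?_, ?_⟩
      · have := dvd_add hw1 (dvd_mul_right c N)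
        simpa [residueClass, sub_add_eq_add_sub] using this
      · have := dvd_add hw2 (dvd_mul_left N c)
        simpa [residueClass, sub_add_eq_add_sub] using this
    · exact ⟨⟨w, hw⟩, hcU hw1, hw2⟩

end GolombSpace

/-! ### A topological comparison of pairs of points -/

/-- The pair `(x', y')` is closure-finer than `(x, y)`: the sets `closure U' ∩ closure V'`, for
neighbourhoods `U'` of `x'` and `V'` of `y'`, are cofinal below the sets `closure U ∩ closure V`,
for neighbourhoods `U` of `x` and `V` of `y`. -/
def ClosureFiner {X : Type*} [TopologicalSpace X] (x y x' y' : X) : Prop :=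
  ∀ U V : Set X, IsOpen U → IsOpen V → x ∈ U → y ∈ V →
    ∃ U' V' : Set X, IsOpen U' ∧ IsOpen V' ∧ x' ∈ U' ∧ y' ∈ V' ∧
      closure U' ∩ closure V' ⊆ closure U ∩ closure V

theorem ClosureFiner.map {X Y : Type*} [TopologicalSpace X] [TopologicalSpace Y] (h : X ≃ₜ Y)
    {x y x' y' : X} (H : ClosureFiner x y x' y') : ClosureFiner (h x) (h y) (h x') (h y') := by
  intro U V hU hV hx hy
  obtain ⟨U', V', hU', hV', hx', hy', hsub⟩ :=
    H (h ⁻¹' U) (h ⁻¹' V) (hU.preimage h.continuous) (hV.preimage h.continuous) hx hy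
  refine ⟨h '' U', h '' V', h.isOpenMap _ hU', h.isOpenMap _ hV', ⟨_, hx', rfl⟩, ⟨_, hy', rfl⟩, ?_⟩
  rw [← h.image_closure, ← h.image_closure, ← Set.image_inter h.injective]
  rintro _ ⟨z, hz, rfl⟩
  have := hsub hz
  rw [← h.preimage_closure, ← h.preimage_closure] at this
  exact this

theorem closureFiner_map_iff {X Y : Type*} [TopologicalSpace X] [TopologicalSpace Y] (h : X ≃ₜ Y)
    {x y x' y' : X} : ClosureFiner (h x) (h y) (h x') (h y') ↔ ClosureFiner x y x' y' :=
  ⟨fun H => by simpa using H.map h.symm, fun H => H.map h⟩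

namespace GolombSpace

/-- A prime that divides neither of two distinct points divides no point of a closure-finer
pair. -/
theorem ClosureFiner.not_dvd_right {x y x' y' : GolombSpace ℤ} (hxy : x ≠ y)
    (H : ClosureFiner x y x' y') {p : ℕ} (hp : p.Prime) (hx : ¬ (p : ℤ) ∣ x.val)
    (hy : ¬ (p : ℤ) ∣ y.val) : ¬ (p : ℤ) ∣ y'.val := by
  intro hy'
  have hpi := Nat.prime_iff_prime_int.1 hp
  have hp0 : (p : ℤ) ≠ 0 := hpi.ne_zero
  have hne : y.val - x.val ≠ 0 := fun h => hxy (ext_val (sub_eq_zero.1 h).symm)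
  obtain ⟨e, M, hM, hpM⟩ := Int.exists_eq_prime_pow_mul hp hne
  have hnd : ¬ (p : ℤ) ^ (e + 1) ∣ y.val - x.val := by
    rw [hM, pow_succ, mul_dvd_mul_iff_left (pow_ne_zero _ hp0)]
    exact hpM
  have hpe : (p : ℤ) ^ (e + 1) ≠ 0 := pow_ne_zero _ hp0
  obtain ⟨U', V', hU', hV', hxU', hyV', hsub⟩ := H _ _
    (isOpen_residueClass hpe (Int.isCoprime_prime_pow hp hx _).symm)
    (isOpen_residueClass hpe (Int.isCoprime_prime_pow hp hy _).symm)
    (self_mem_residueClass x _) (self_mem_residueClass y _)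
  obtain ⟨N, hN, hxN, hNU⟩ := isOpen_iff.1 hU' _ hxU'
  obtain ⟨M', hM', hyM', hMV⟩ := isOpen_iff.1 hV' _ hyV'
  obtain ⟨l, N', rfl, hpN'⟩ := Int.exists_eq_prime_pow_mul hp hN
  have hpM' := Int.not_dvd_of_isCoprime hyM' hp hy'
  -- A point of both closures near `x'` at `p` (if `p` does not divide `x'`, else near `1`) that is
  -- divisible by all the other primes involved.
  obtain ⟨t, hpt, ht⟩ : ∃ t : ℤ, ¬ (p : ℤ) ∣ t ∧ (¬ (p : ℤ) ∣ x'.val → t = x'.val) := by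
    by_cases hd : (p : ℤ) ∣ x'.val
    · exact ⟨1, fun h => hpi.not_isUnit (isUnit_of_dvd_one h), fun h => absurd hd h⟩
    · exact ⟨x'.val, hd, fun _ => rfl⟩
  obtain ⟨z, hz1, hz2⟩ := Int.exists_dvd_sub_and_dvd_sub
    (Int.isCoprime_prime_pow hp (M := N' * M') (fun h => (hpi.dvd_or_dvd h).elim hpN' hpM') (l + 1))
    t 0
  have hpz : ¬ (p : ℤ) ∣ z := fun h => hpt <| by
    have := dvd_sub h ((dvd_pow_self _ l.succ_ne_zero).trans hz1)
    simpa using this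
  rw [sub_zero] at hz2
  have hz0 : z ≠ 0 := by rintro rfl; simp at hpz
  have hmem : (⟨z, hz0⟩ : GolombSpace ℤ) ∈ closure U' ∩ closure V' := by
    constructor
    · refine closure_mono hNU ((mem_closure_residueClass hN).2 fun q hq hqz k hk => ?_)
      have hqN' : ¬ (q : ℤ) ∣ N' := fun h => hqz ((h.mul_right _).trans hz2)
      rcases Nat.eq_zero_or_pos k with rfl | hk0
      · simp
      have h1 := Int.prime_pow_dvd_left hq hk hqN'
      have hqp : q = p := (Nat.prime_dvd_prime_iff_eq hq hp).1 <| by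
        have := (Nat.prime_iff_prime_int.1 hq).dvd_of_dvd_pow ((dvd_pow_self _ hk0.ne').trans h1)
        exact_mod_cast this
      subst hqp
      have hx't : ¬ (q : ℤ) ∣ x'.val := fun h =>
        Int.not_dvd_of_isCoprime hxN hq h ((dvd_pow_self _ hk0.ne').trans hk)
      rw [← ht hx't]
      exact (h1.trans (pow_dvd_pow _ l.le_succ)).trans hz1
    · refine closure_mono hMV ((mem_closure_residueClass hM').2 fun q hq hqz k hk => ?_)
      rcases Nat.eq_zero_or_pos k with rfl | hk0
      · simp
      exact absurd (((dvd_pow_self _ hk0.ne').trans hk).trans ((dvd_mul_left _ _).trans hz2)) hqz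
  obtain ⟨h1, h2⟩ := hsub hmem
  have h3 := (mem_closure_residueClass hpe).1 h1 p hp hpz _ dvd_rfl
  have h4 := (mem_closure_residueClass hpe).1 h2 p hp hpz _ dvd_rfl
  exact hnd (by simpa using dvd_sub h3 h4)

/-- If `x'` is a unit different from `y'` and every prime dividing `y'` divides `y`, then
`(x', y')` is closure-finer than `(x, y)`, provided that `x' = x` or that `y'` is a unit. -/
theorem closureFiner_of_dvd {x y x' y' : GolombSpace ℤ} (hu : IsUnit x'.val) (hne : x' ≠ y')
    (hd : ∀ p : ℕ, p.Prime → (p : ℤ) ∣ y'.val → (p : ℤ) ∣ y.val ∧ x' = x) :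
    ClosureFiner x y x' y' := by
  intro U V hU hV hx hy
  obtain ⟨N, hN, hxN, hNU⟩ := isOpen_iff.1 hU _ hx
  obtain ⟨M, hM, hyM, hMV⟩ := isOpen_iff.1 hV _ hy
  have hne' : y'.val - x'.val ≠ 0 := fun h => hne (ext_val (sub_eq_zero.1 h).symm)
  have hK : N * M * (y'.val - x'.val) ≠ 0 := mul_ne_zero (mul_ne_zero hN hM) hne'
  obtain ⟨L, hL0, hLy, hL⟩ := Int.exists_coprime_part hK y'.val
  obtain ⟨u, hxu⟩ := isUnit_iff_exists_inv.1 hu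
  refine ⟨_, _, isOpen_residueClass hK ⟨u, 0, by linear_combination hxu⟩,
    isOpen_residueClass hL0 hLy, self_mem_residueClass x' _, self_mem_residueClass y' _, ?_⟩
  rintro z ⟨hz1, hz2⟩
  rw [mem_closure_residueClass hK] at hz1
  rw [mem_closure_residueClass hL0] at hz2
  -- A prime dividing `N * M` but not `y'` has to divide `z`.
  have key : ∀ p : ℕ, p.Prime → (p : ℤ) ∣ N * M → ¬ (p : ℤ) ∣ y'.val → (p : ℤ) ∣ z.val := by
    intro p hp hpN hpy
    by_contra hpz
    obtain ⟨e, c, hc, hpc⟩ := Int.exists_eq_prime_pow_mul hp hne'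
    have hdvd : (p : ℤ) ^ (e + 1) ∣ N * M * (y'.val - x'.val) := by
      rw [pow_succ']
      exact mul_dvd_mul hpN ⟨c, hc⟩
    have h1 := dvd_sub (hz1 p hp hpz _ hdvd) (hz2 p hp hpz _ (hL p hp hpy _ hdvd))
    rw [sub_sub_sub_cancel_left, hc, pow_succ, mul_dvd_mul_iff_left
      (pow_ne_zero _ (by exact_mod_cast hp.ne_zero))] at h1
    exact hpc h1
  constructor
  · refine closure_mono hNU ((mem_closure_residueClass hN).2 fun p hp hpz k hk => ?_)
    rcases Nat.eq_zero_or_pos k with rfl | hk0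
    · simp
    have hpN : (p : ℤ) ∣ N := (dvd_pow_self _ hk0.ne').trans hk
    have hpy : (p : ℤ) ∣ y'.val := by
      by_contra hpy
      exact hpz (key p hp (hpN.mul_right _) hpy)
    rw [← (hd p hp hpy).2]
    exact hz1 p hp hpz k ((hk.mul_right _).mul_right _)
  · refine closure_mono hMV ((mem_closure_residueClass hM).2 fun p hp hpz k hk => ?_)
    rcases Nat.eq_zero_or_pos k with rfl | hk0
    · simp
    have hpM : (p : ℤ) ∣ M := (dvd_pow_self _ hk0.ne').trans hk
    refine absurd (key p hp (hpM.mul_left _) fun hpy => ?_) hpz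
    exact Int.not_dvd_of_isCoprime hyM hp (hd p hp hpy).1 hpM

/-! ### The traces of closed-open sets are open in the `p`-adic topology -/

/-- If disjoint open sets `C` and `D` cover the set of integers prime to `p`, then the trace of `C`
on this set is open in the `p`-adic topology. -/
theorem exists_pow_residueClass_subset {p : ℕ} (hp : p.Prime) {C D : Set (GolombSpace ℤ)}
    (hC : IsOpen C) (hD : IsOpen D) (hCD : Disjoint C D)
    (hcov : ∀ z : GolombSpace ℤ, ¬ (p : ℤ) ∣ z.val → z ∈ C ∪ D) {x : GolombSpace ℤ}
    (hpx : ¬ (p : ℤ) ∣ x.val) (hx : x ∈ C) :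
    ∃ m : ℕ, m ≠ 0 ∧ residueClass x.val ((p : ℤ) ^ m) ⊆ C := by
  have hpi := Nat.prime_iff_prime_int.1 hp
  obtain ⟨N, hN, hxN, hNC⟩ := isOpen_iff.1 hC x hx
  obtain ⟨m, c, rfl, hpc⟩ := Int.exists_eq_prime_pow_mul hp hN
  refine ⟨m + 1, m.succ_ne_zero, fun y hy => ?_⟩
  have hpy : ¬ (p : ℤ) ∣ y.val := fun h => hpx <| by
    have := dvd_sub h ((dvd_pow_self _ m.succ_ne_zero).trans (show _ ∣ y.val - x.val from hy))
    simpa using this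
  refine (hcov y hpy).resolve_right fun hyD => ?_
  obtain ⟨N', hN', hyN', hND⟩ := isOpen_iff.1 hD y hyD
  obtain ⟨l, d, rfl, hpd⟩ := Int.exists_eq_prime_pow_mul hp hN'
  -- A point `u` that is close to `y` at `p` and divisible by all the other primes involved lies in
  -- the closures of both `C` and `D`, which cannot happen, as it lies in `C` or in `D`.
  obtain ⟨u, hu1, hu2⟩ := Int.exists_dvd_sub_and_dvd_sub
    (Int.isCoprime_prime_pow hp (M := c * d) (fun h => (hpi.dvd_or_dvd h).elim hpc hpd)
      (l + m + 1)) y.val 0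
  rw [sub_zero] at hu2
  have hpu : ¬ (p : ℤ) ∣ u := fun h => hpy <| by
    have := dvd_sub h ((dvd_pow_self _ (Nat.succ_ne_zero _)).trans hu1)
    simpa using this
  have hu0 : u ≠ 0 := by rintro rfl; simp at hpu
  have huD : (⟨u, hu0⟩ : GolombSpace ℤ) ∈ closure D := by
    refine closure_mono hND ((mem_closure_residueClass hN').2 fun q hq hqu k hk => ?_)
    have h1 := Int.prime_pow_dvd_left hq hk fun h => hqu ((h.mul_left c).trans hu2)
    exact (h1.trans (pow_dvd_pow _ (by omega))).trans hu1
  have huC : (⟨u, hu0⟩ : GolombSpace ℤ) ∈ closure C := by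
    refine closure_mono hNC ((mem_closure_residueClass hN).2 fun q hq hqu k hk => ?_)
    have h1 := Int.prime_pow_dvd_left hq hk fun h => hqu ((h.mul_right d).trans hu2)
    have h2 := dvd_add ((h1.trans (pow_dvd_pow _ (show m ≤ l + m + 1 by omega))).trans hu1)
      ((h1.trans (pow_dvd_pow _ m.le_succ)).trans (show _ ∣ y.val - x.val from hy))
    simpa using h2
  rcases hcov ⟨u, hu0⟩ hpu with h | h
  · exact Set.disjoint_left.1 (hCD.closure_right hC) h huD
  · exact Set.disjoint_left.1 (hCD.closure_left hD) huC h

end GolombSpace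

/-! ### The arithmetic properties of a self-homeomorphism -/

/-- The arithmetic properties of a self-homeomorphism `H` of the Golomb space of `ℤ` (extended by
`H 0 = 0`) with inverse `K`, where `σ` is the permutation of the prime numbers that `H` induces,
with inverse `ρ`. The structure contains one half of each property, so that it is used for
`H K σ ρ` and for `K H ρ σ` together. -/
structure IsGolombMap (H K : ℤ → ℤ) (σ ρ : ℕ → ℕ) : Prop where
  left_inv : ∀ x, K (H x) = x
  prime : ∀ p : ℕ, p.Prime → (σ p).Prime
  prime_left_inv : ∀ p : ℕ, p.Prime → ρ (σ p) = p
  dvd_iff : ∀ p : ℕ, p.Prime → ∀ x : ℤ, ((σ p : ℕ) : ℤ) ∣ H x ↔ (p : ℤ) ∣ x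
  /-- Continuity for the Golomb topology. -/
  cont : ∀ x N : ℤ, x ≠ 0 → N ≠ 0 → IsCoprime (H x) N →
    ∃ M : ℤ, M ≠ 0 ∧ IsCoprime x M ∧ ∀ z, M ∣ z - x → N ∣ H z - H x
  /-- Continuity from the `p`-adic to the `σ p`-adic topology, away from the multiples of `p`. -/
  prime_cont : ∀ p : ℕ, p.Prime → ∀ x : ℤ, ¬ (p : ℤ) ∣ x → ∀ k : ℕ,
    ∃ m : ℕ, ∀ z : ℤ, (p : ℤ) ^ m ∣ z - x → ((σ p : ℕ) : ℤ) ^ k ∣ H z - H x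

/-- Dirichlet's theorem: there are arbitrarily large primes in a coprime residue class. -/
theorem Int.exists_prime_gt_and_dvd_sub {x M : ℤ} (hM : M ≠ 0) (h : IsCoprime x M) (n : ℕ) :
    ∃ z : ℕ, n < z ∧ z.Prime ∧ M ∣ (z : ℤ) - x := by
  have h' : IsCoprime x ((M.natAbs : ℕ) : ℤ) := by
    rw [Int.isCoprime_iff_gcd_eq_one] at h ⊢
    rwa [Int.gcd, Int.natAbs_natCast]
  obtain ⟨z, hz, hzp, hmod⟩ := Nat.forall_exists_prime_gt_and_zmodEq n (by simpa using hM) h'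
  exact ⟨z, hz, hzp, by simpa using (Int.natAbs_dvd.1 hmod.symm.dvd)⟩

/-- If, for every `t`, the integer `Y` is congruent up to sign to a power of `X` modulo `X ^ t - 1`,
then `Y` is up to sign a power of `X`. -/
theorem Int.exists_natAbs_eq_pow {X Y : ℤ} (hX : 2 ≤ X)
    (h : ∀ t : ℕ, t ≠ 0 → ∃ c : ℕ, X ^ t - 1 ∣ Y - X ^ c ∨ X ^ t - 1 ∣ Y + X ^ c) :
    ∃ j : ℕ, (Y.natAbs : ℤ) = X ^ j := by
  obtain ⟨t, ht⟩ : ∃ t : ℕ, t = Y.natAbs + 2 := ⟨_, rfl⟩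
  obtain ⟨c, hc⟩ := h (t + 1) t.succ_ne_zero
  -- Exponents of `X` matter only modulo `t + 1`.
  have hred : X ^ (t + 1) - 1 ∣ X ^ c - X ^ (c % (t + 1)) := by
    have h1 : X ^ (t + 1) - 1 ∣ (X ^ (t + 1)) ^ (c / (t + 1)) - 1 := by
      simpa using sub_dvd_pow_sub_pow (X ^ (t + 1)) 1 (c / (t + 1))
    have h2 : X ^ c - X ^ (c % (t + 1)) =
        ((X ^ (t + 1)) ^ (c / (t + 1)) - 1) * X ^ (c % (t + 1)) := by
      rw [← pow_mul, sub_mul, ← pow_add, Nat.div_add_mod, one_mul]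
    exact h2 ▸ h1.mul_right _
  have hle : X ^ (c % (t + 1)) ≤ X ^ t :=
    pow_le_pow_right₀ (by omega) (Nat.lt_succ_iff.1 (Nat.mod_lt _ t.succ_pos))
  have hpos : 0 < X ^ (c % (t + 1)) := by positivity
  have hXt : 2 * X ^ t ≤ X ^ (t + 1) := by
    rw [pow_succ']
    exact mul_le_mul_of_nonneg_right hX (by positivity)
  have hY : (Y.natAbs : ℤ) + 2 ≤ X ^ t - 1 := by
    have h1 : t < 2 ^ t := Nat.lt_two_pow_self
    have h2 : (2 : ℤ) ^ t ≤ X ^ t := pow_le_pow_left₀ (by norm_num) hX t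
    have h3 : (t : ℤ) < 2 ^ t := by exact_mod_cast h1
    omega
  refine ⟨c % (t + 1), ?_⟩
  rcases hc with hc | hc
  · have h1 : X ^ (t + 1) - 1 ∣ Y - X ^ (c % (t + 1)) := by simpa using dvd_add hc hred
    have := Int.eq_zero_of_abs_lt_dvd h1 (by rw [abs_lt]; constructor <;> omega)
    omega
  · have h1 : X ^ (t + 1) - 1 ∣ Y + X ^ (c % (t + 1)) := by
      have := dvd_sub hc hred
      rwa [show Y + X ^ c - (X ^ c - X ^ (c % (t + 1))) = Y + X ^ (c % (t + 1)) by ring] at this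
    have := Int.eq_zero_of_abs_lt_dvd h1 (by rw [abs_lt]; constructor <;> omega)
    omega

namespace IsGolombMap

variable {H K : ℤ → ℤ} {σ ρ : ℕ → ℕ}

theorem isCoprime_iff (A : IsGolombMap H K σ ρ) (B : IsGolombMap K H ρ σ) {x y : ℤ}
    (hy : ∀ p : ℕ, p.Prime → ((p : ℤ) ∣ y ↔ (p : ℤ) ∣ H x)) {N : ℤ} :
    IsCoprime (K y) N ↔ IsCoprime x N := by
  have hd : ∀ p : ℕ, p.Prime → ((p : ℤ) ∣ K y ↔ (p : ℤ) ∣ x) := fun p hp => by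
    rw [← A.dvd_iff p hp x, ← hy _ (A.prime p hp), ← B.dvd_iff _ (A.prime p hp) y,
      A.prime_left_inv p hp]
  exact ⟨fun h => Int.isCoprime_of_forall_prime fun p hp h1 =>
      Int.not_dvd_of_isCoprime h hp ((hd p hp).2 h1),
    fun h => Int.isCoprime_of_forall_prime fun p hp h1 =>
      Int.not_dvd_of_isCoprime h hp ((hd p hp).1 h1)⟩

theorem map_ne_zero (A : IsGolombMap H K σ ρ) {x : ℤ} (hx : x ≠ 0) :
    H x ≠ 0 := by
  intro h0
  obtain ⟨p, hp1, hp2⟩ := Nat.exists_infinite_primes (x.natAbs + 1)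
  have h1 : (p : ℤ) ∣ x := (A.dvd_iff p hp2 x).1 (h0 ▸ dvd_zero _)
  have := Nat.le_of_dvd (Int.natAbs_pos.2 hx) (Int.natCast_dvd.1 h1)
  omega

/-- Up to sign, prime powers are mapped to prime powers. -/
theorem exists_natAbs_map_prime_pow (A : IsGolombMap H K σ ρ) (B : IsGolombMap K H ρ σ) {z : ℕ}
    (hz : z.Prime) {n : ℕ} {w : ℤ} (hw : w.natAbs = z ^ n) :
    ∃ a : ℕ, (H w).natAbs = (σ z) ^ a := by
  have hw0 : w ≠ 0 := by
    rintro rfl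
    exact pow_ne_zero n hz.ne_zero hw.symm
  refine ⟨_, Nat.eq_prime_pow_of_unique_prime_dvd
    (Int.natAbs_ne_zero.2 (A.map_ne_zero hw0)) fun {d} hd hdvd => ?_⟩
  have h1 : ((ρ d : ℕ) : ℤ) ∣ w := by
    rw [← A.dvd_iff _ (B.prime d hd), B.prime_left_inv d hd]
    exact Int.natCast_dvd.2 hdvd
  have h2 : ρ d ∣ z := (B.prime d hd).dvd_of_dvd_pow (hw ▸ Int.natCast_dvd.1 h1)
  rw [← (Nat.prime_dvd_prime_iff_eq (B.prime d hd) hz).1 h2, B.prime_left_inv d hd]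

/-- Powers are mapped to powers, up to sign. To see this, approximate `x` by primes `z`, for which
`H` maps the powers of `z` to powers of `σ z`, and use that an integer is up to sign a power of `x`
if it is so modulo all integers coprime to `x`. -/
theorem exists_natAbs_symm_eq_pow (A : IsGolombMap H K σ ρ) (B : IsGolombMap K H ρ σ) {x : ℤ}
    (hx : 1 < x.natAbs) {n : ℕ} (hn : n ≠ 0) {y : ℤ} (hy : y.natAbs = (H x).natAbs ^ n) :
    ∃ c : ℕ, c ≠ 0 ∧ (K y).natAbs = x.natAbs ^ c := by
  have hx0 : x ≠ 0 := by rintro rfl; simp at hx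
  have hHx := A.map_ne_zero hx0
  have hy0 : y ≠ 0 := by
    rw [← Int.natAbs_ne_zero, hy]
    exact pow_ne_zero _ (Int.natAbs_ne_zero.2 hHx)
  have hyd : ∀ p : ℕ, p.Prime → ((p : ℤ) ∣ y ↔ (p : ℤ) ∣ H x) := fun p hp => by
    rw [Int.natCast_dvd, Int.natCast_dvd, hy, hp.prime.dvd_pow_iff_dvd hn]
  obtain ⟨ε, hε, hyε⟩ : ∃ ε : ℤ, ε.natAbs = 1 ∧ y = ε * H x ^ n := by
    rcases Int.natAbs_eq_natAbs_iff.1 (hy.trans (Int.natAbs_pow _ _).symm) with h | h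
    · exact ⟨1, rfl, by rw [h, one_mul]⟩
    · exact ⟨-1, rfl, by rw [h, neg_one_mul]⟩
  have key : ∀ t : ℕ, t ≠ 0 → ∃ c : ℕ, (x.natAbs : ℤ) ^ t - 1 ∣ K y - (x.natAbs : ℤ) ^ c ∨
      (x.natAbs : ℤ) ^ t - 1 ∣ K y + (x.natAbs : ℤ) ^ c := by
    intro t ht
    have hN0 : (x.natAbs : ℤ) ^ t - 1 ≠ 0 := by
      have h1 := Nat.one_lt_pow ht hx
      have h2 : (1 : ℤ) < (x.natAbs : ℤ) ^ t := by exact_mod_cast h1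
      omega
    have hcop : IsCoprime x ((x.natAbs : ℤ) ^ t - 1) := by
      refine Int.isCoprime_of_forall_prime fun p hp h1 h2 => ?_
      have h3 : (p : ℤ) ∣ (x.natAbs : ℤ) ^ t := dvd_pow (Int.dvd_natAbs.2 h1) ht
      have h4 := dvd_sub h3 h2
      rw [sub_sub_cancel] at h4
      exact (Nat.prime_iff_prime_int.1 hp).not_isUnit (isUnit_of_dvd_one h4)
    generalize hNdef : (x.natAbs : ℤ) ^ t - 1 = N at hN0 hcop ⊢
    obtain ⟨N', hN'0, hyN', hN'⟩ := B.cont y N hy0 hN0 ((A.isCoprime_iff B hyd).2 hcop)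
    have hHxN' : IsCoprime (H x) N' := Int.isCoprime_of_forall_prime fun p hp h1 =>
      Int.not_dvd_of_isCoprime hyN' hp ((hyd p hp).2 h1)
    obtain ⟨M, hM0, hxM, hM⟩ := A.cont x N' hx0 hN'0 hHxN'
    obtain ⟨z, -, hzp, hz⟩ :=
      Int.exists_prime_gt_and_dvd_sub (mul_ne_zero hM0 hN0) (hxM.mul_right hcop) 0
    have hHz : N' ∣ ε * H z ^ n - y := by
      rw [hyε, ← mul_sub]
      exact ((hM z ((dvd_mul_right M N).trans hz)).trans (sub_dvd_pow_sub_pow _ _ n)).mul_left _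
    have hKz := hN' _ hHz
    obtain ⟨a, ha⟩ := A.exists_natAbs_map_prime_pow B hzp (w := z) (n := 1) (by simp)
    obtain ⟨c, hc⟩ := B.exists_natAbs_map_prime_pow A (A.prime z hzp) (w := ε * H z ^ n)
      (n := a * n) (by rw [Int.natAbs_mul, hε, one_mul, Int.natAbs_pow, ha, pow_mul])
    rw [A.prime_left_inv z hzp] at hc
    have hzx : N ∣ (z : ℤ) ^ c - x ^ c :=
      ((dvd_mul_left N M).trans hz).trans (sub_dvd_pow_sub_pow _ _ c)
    have hc' : (K (ε * H z ^ n)).natAbs = ((z : ℤ) ^ c).natAbs := by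
      rw [hc, Int.natAbs_pow, Int.natAbs_natCast]
    have hxc : x ^ c = (x.natAbs : ℤ) ^ c ∨ x ^ c = - (x.natAbs : ℤ) ^ c := by
      have : (x ^ c).natAbs = ((x.natAbs : ℤ) ^ c).natAbs := by
        rw [Int.natAbs_pow, Int.natAbs_pow, Int.natAbs_natCast]
      exact Int.natAbs_eq_natAbs_iff.1 this
    -- So `K y` is congruent to one of `± |x| ^ c`.
    have hfin : N ∣ K y - x ^ c ∨ N ∣ K y + x ^ c := by
      rcases Int.natAbs_eq_natAbs_iff.1 hc' with h | h
      · left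
        have := dvd_sub hzx hKz
        rw [h] at this
        simpa using this
      · right
        have := dvd_add hzx hKz
        rw [h] at this
        rw [← dvd_neg]
        convert this using 1
        ring
    refine ⟨c, ?_⟩
    rcases hxc with h | h
    · rwa [h] at hfin
    · rw [h, sub_neg_eq_add, ← sub_eq_add_neg] at hfin
      exact hfin.symm
  obtain ⟨c, hc⟩ := Int.exists_natAbs_eq_pow (by exact_mod_cast hx) key
  have hc' : (K y).natAbs = x.natAbs ^ c := by exact_mod_cast hc
  refine ⟨c, ?_, hc'⟩
  rintro rfl
  obtain ⟨p, hp, hpx⟩ := Nat.exists_prime_and_dvd (show x.natAbs ≠ 1 by omega)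
  refine Int.not_dvd_of_isCoprime ((A.isCoprime_iff B hyd (N := x)).1 ?_) hp
    (Int.natCast_dvd.2 hpx) (Int.natCast_dvd.2 hpx)
  rw [pow_zero] at hc'
  exact Int.isCoprime_iff_gcd_eq_one.2 (by simp [Int.gcd, hc'])

theorem one_lt_natAbs_map (A : IsGolombMap H K σ ρ) {x : ℤ}
    (hx : 1 < x.natAbs) : 1 < (H x).natAbs := by
  obtain ⟨p, hp, hpx⟩ := Nat.exists_prime_and_dvd (show x.natAbs ≠ 1 by omega)
  have h1 := (A.dvd_iff p hp x).2 (Int.natCast_dvd.2 hpx)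
  have h0 : (H x).natAbs ≠ 0 :=
    Int.natAbs_ne_zero.2 (A.map_ne_zero (by rintro rfl; simp at hx))
  exact (A.prime p hp).one_lt.trans_le
    (Nat.le_of_dvd (Nat.pos_of_ne_zero h0) (Int.natCast_dvd.1 h1))

theorem exists_natAbs_map_eq_pow (A : IsGolombMap H K σ ρ) (B : IsGolombMap K H ρ σ) {x : ℤ}
    (hx : 1 < x.natAbs) {n : ℕ} (hn : n ≠ 0) {y : ℤ} (hy : y.natAbs = x.natAbs ^ n) :
    ∃ c : ℕ, c ≠ 0 ∧ (H y).natAbs = (H x).natAbs ^ c := by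
  exact B.exists_natAbs_symm_eq_pow A (x := H x) (A.one_lt_natAbs_map hx) hn
    (by rw [A.left_inv, hy])

/-- Up to sign, `H x` depends only on `x` up to sign. -/
theorem natAbs_map_congr (A : IsGolombMap H K σ ρ) (B : IsGolombMap K H ρ σ) {x y : ℤ}
    (hx : 1 < x.natAbs) (h : x.natAbs = y.natAbs) : (H x).natAbs = (H y).natAbs := by
  obtain ⟨a, ha, h1⟩ := A.exists_natAbs_map_eq_pow B hx one_ne_zero (y := y) (by simp [h])
  obtain ⟨b, hb, h2⟩ := A.exists_natAbs_map_eq_pow B (h ▸ hx) one_ne_zero (y := x) (by simp [h])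
  apply le_antisymm
  · rw [h1]
    exact Nat.le_pow (Nat.pos_of_ne_zero ha)
  · rw [h2]
    exact Nat.le_pow (Nat.pos_of_ne_zero hb)

theorem natAbs_map_prime (A : IsGolombMap H K σ ρ) (B : IsGolombMap K H ρ σ) {r : ℕ}
    (hr : r.Prime) : (H r).natAbs = σ r := by
  obtain ⟨a, ha⟩ := A.exists_natAbs_map_prime_pow B hr (w := r) (n := 1) (by simp)
  obtain ⟨b, hb⟩ := B.exists_natAbs_map_prime_pow A (A.prime r hr) (w := (σ r : ℕ)) (n := 1)
    (by simp)
  rw [A.prime_left_inv r hr] at hb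
  have hb0 : b ≠ 0 := by
    rintro rfl
    have := B.one_lt_natAbs_map (x := (σ r : ℕ)) (by simpa using (A.prime r hr).one_lt)
    rw [hb, pow_zero] at this
    omega
  obtain ⟨c, -, h⟩ := A.exists_natAbs_map_eq_pow B (x := r) (by simpa using hr.one_lt) hb0
    (y := K (σ r : ℕ)) (by simpa using hb)
  rw [B.left_inv, Int.natAbs_natCast, ha, ← pow_mul] at h
  have hac : a * c = 1 := Nat.pow_right_injective (A.prime r hr).two_le (by simpa using h.symm)
  rw [ha, Nat.eq_one_of_mul_eq_one_right hac, pow_one]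

end IsGolombMap

/-! ### Divisibility automorphisms of the positive integers -/

/-- A bijection of the positive integers that preserves divisibility in both directions maps
primes to primes and is multiplicative on the powers of a prime. -/
theorem Nat.divisibility_automorphism {f g : ℕ → ℕ}
    (hf : ∀ n, n ≠ 0 → f n ≠ 0) (hg : ∀ n, n ≠ 0 → g n ≠ 0)
    (hgf : ∀ n, n ≠ 0 → g (f n) = n) (hfg : ∀ n, n ≠ 0 → f (g n) = n)
    (mf : ∀ m n, m ≠ 0 → n ≠ 0 → m ∣ n → f m ∣ f n)
    (mg : ∀ m n, m ≠ 0 → n ≠ 0 → m ∣ n → g m ∣ g n) {l : ℕ} (hl : l.Prime) :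
    (f l).Prime ∧ ∀ j, f (l ^ j) = f l ^ j := by
  have f1 : f 1 = 1 := by
    have := mf 1 (g 1) one_ne_zero (hg 1 one_ne_zero) (one_dvd _)
    rwa [hfg 1 one_ne_zero, Nat.dvd_one] at this
  have hfl0 := hf l hl.ne_zero
  -- The divisors of `f (l ^ j)` are the `f (l ^ i)` with `i ≤ j`.
  have key : ∀ j d, d ∣ f (l ^ j) → ∃ i ≤ j, d = f (l ^ i) := by
    intro j d hd
    have hlj : l ^ j ≠ 0 := pow_ne_zero _ hl.ne_zero
    have hd0 : d ≠ 0 := ne_zero_of_dvd_ne_zero (hf _ hlj) hd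
    have h1 := mg d _ hd0 (hf _ hlj) hd
    rw [hgf _ hlj] at h1
    obtain ⟨i, hi, h2⟩ := (Nat.dvd_prime_pow hl).1 h1
    exact ⟨i, hi, by rw [← h2, hfg d hd0]⟩
  have hprime : (f l).Prime := by
    refine Nat.prime_def.2 ⟨?_, fun d hd => ?_⟩
    · have : f l ≠ 1 := fun h => hl.ne_one <| by
        have h1 := congrArg g (h.trans f1.symm)
        rwa [hgf l hl.ne_zero, hgf 1 one_ne_zero] at h1
      omega
    · obtain ⟨i, hi, rfl⟩ := key 1 d (by simpa using hd)
      interval_cases i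
      · left; simpa using f1
      · right; simp
  refine ⟨hprime, fun j => ?_⟩
  induction j using Nat.strong_induction_on with
  | _ j ih =>
    have hinj : ∀ i, i < j → f (l ^ i) ≠ f (l ^ j) := fun i hi h => by
      have h1 := congrArg g h
      rw [hgf _ (pow_ne_zero _ hl.ne_zero), hgf _ (pow_ne_zero _ hl.ne_zero)] at h1
      exact hi.ne (Nat.pow_right_injective hl.two_le h1)
    obtain ⟨e, he⟩ : ∃ e, f (l ^ j) = f l ^ e := by
      refine ⟨_, Nat.eq_prime_pow_of_unique_prime_dvd (hf _ (pow_ne_zero _ hl.ne_zero))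
        fun {d} hd hdj => ?_⟩
      obtain ⟨i, hi, rfl⟩ := key j d hdj
      have hi0 : i ≠ 0 := by
        rintro rfl
        rw [pow_zero, f1] at hd
        exact Nat.not_prime_one hd
      have := mf l (l ^ i) hl.ne_zero (pow_ne_zero _ hl.ne_zero) (dvd_pow_self _ hi0)
      exact ((Nat.prime_dvd_prime_iff_eq hprime hd).1 this).symm
    have hje : j ≤ e := by
      by_contra hlt
      push Not at hlt
      exact hinj e hlt (by rw [ih e hlt, he])
    obtain ⟨i, hi, h⟩ := key j (f l ^ j) (he ▸ pow_dvd_pow _ hje)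
    rcases hi.lt_or_eq with hlt | rfl
    · rw [ih i hlt] at h
      exact absurd (Nat.pow_right_injective hprime.two_le h) hlt.ne'
    · exact h.symm

/-! ### Orders modulo the powers of a prime -/

/-- The square of `b` is a limit of even powers of `a` with positive exponents, in the `p`-adic
topology. The squares make the relation insensitive to the signs of `a` and `b`. -/
def PadicPowerLimit (p a b : ℕ) : Prop :=
  ∀ k : ℕ, ∃ j : ℕ, j ≠ 0 ∧ a ^ (2 * j) ≡ b ^ 2 [MOD p ^ k]

/-- The order of `r ^ 2` modulo `p ^ k`. -/
noncomputable def orderSq (p r k : ℕ) : ℕ := orderOf ((r : ZMod (p ^ k)) ^ 2)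

theorem orderSq_modEq_iff {p r k : ℕ} (h : r.Coprime p) (a b : ℕ) :
    r ^ (2 * a) ≡ r ^ (2 * b) [MOD p ^ k] ↔ a ≡ b [MOD orderSq p r k] := by
  have hu := ZMod.coe_unitOfCoprime r (h.pow_right k)
  rw [orderSq, ← hu, ← Units.val_pow_eq_pow_val, orderOf_units, ← pow_eq_pow_iff_modEq,
    Units.ext_iff, ← ZMod.natCast_eq_natCast_iff]
  push_cast [hu]
  rw [pow_mul, pow_mul]

theorem orderSq_dvd_iff {p r k : ℕ} (h : r.Coprime p) (a : ℕ) :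
    orderSq p r k ∣ a ↔ r ^ (2 * a) ≡ 1 [MOD p ^ k] := by
  have := orderSq_modEq_iff (k := k) h a 0
  rw [mul_zero, pow_zero] at this
  rw [this, Nat.modEq_zero_iff_dvd]

theorem orderSq_dvd {p r : ℕ} (hp : p.Prime) (h : r.Coprime p) (k : ℕ) :
    orderSq p r k ∣ (p / 2) * p ^ k := by
  rw [orderSq_dvd_iff h]
  have h1 : (p ^ k).totient ∣ 2 * ((p / 2) * p ^ k) := by
    rcases Nat.eq_zero_or_pos k with rfl | hk
    · simp
    · rw [Nat.totient_prime_pow hp hk, mul_comm, ← mul_assoc]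
      refine mul_dvd_mul ?_ (pow_dvd_pow _ (Nat.sub_le _ _))
      rcases hp.eq_two_or_odd with rfl | hodd
      · simp
      · exact dvd_of_eq (by omega)
  obtain ⟨c, hc⟩ := h1
  rw [hc, pow_mul]
  simpa using (Nat.ModEq.pow_totient (h.pow_right k)).pow c

theorem orderSq_ne_zero {p r : ℕ} (hp : p.Prime) (h : r.Coprime p) (k : ℕ) : orderSq p r k ≠ 0 :=
  ne_zero_of_dvd_ne_zero (mul_ne_zero (by have := hp.two_le; omega) (pow_ne_zero _ hp.ne_zero))
    (orderSq_dvd hp h k)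

theorem Nat.exists_mul_modEq {n o g : ℕ} (ho : o ≠ 0) (h : n.gcd o ∣ g) :
    ∃ i, i ≠ 0 ∧ n * i ≡ g [MOD o] := by
  obtain ⟨c, rfl⟩ := h
  refine ⟨((Nat.gcdA n o * c) % o).toNat + o, by omega, ?_⟩
  rw [← Int.natCast_modEq_iff, Int.modEq_iff_dvd]
  have h1 := Nat.gcd_eq_gcd_ab n o
  have h2 := Int.emod_nonneg (Nat.gcdA n o * c) (show (o : ℤ) ≠ 0 by exact_mod_cast ho)
  have h3 := Int.emod_def (Nat.gcdA n o * c) o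
  push_cast [Int.toNat_of_nonneg h2]
  rw [h3, h1]
  exact ⟨Nat.gcdB n o * c + n * (Nat.gcdA n o * c / o) - n, by ring⟩

/-- The relation `PadicPowerLimit` detects the prime powers dividing the orders modulo `p ^ k`. -/
theorem exists_pow_dvd_orderSq_iff {p r l : ℕ} (hp : p.Prime) (h : r.Coprime p) (hl : l.Prime)
    (j : ℕ) : (∃ k, l ^ (j + 1) ∣ orderSq p r k) ↔
      ¬ PadicPowerLimit p (r ^ l ^ (j + 1)) (r ^ l ^ j) := by
  have key : ∀ i k, (r ^ l ^ (j + 1)) ^ (2 * i) ≡ (r ^ l ^ j) ^ 2 [MOD p ^ k] ↔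
      l ^ (j + 1) * i ≡ l ^ j [MOD orderSq p r k] := fun i k => by
    rw [← orderSq_modEq_iff h, ← pow_mul, ← pow_mul, mul_left_comm, mul_comm (l ^ j) 2]
  constructor
  · rintro ⟨k, hk⟩ H
    obtain ⟨i, -, hi⟩ := H k
    have h1 := ((key i k).1 hi).of_dvd hk
    have h2 := (h1.dvd_iff dvd_rfl).1 (dvd_mul_right _ _)
    have := (Nat.pow_dvd_pow_iff_le_right hl.one_lt).1 h2
    omega
  · intro H
    by_contra hcon
    push Not at hcon
    refine H fun k => ?_
    obtain ⟨e, he, hgcd⟩ := (Nat.dvd_prime_pow hl).1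
      (Nat.gcd_dvd_left (l ^ (j + 1)) (orderSq p r k))
    have hej : e ≤ j := by
      by_contra hlt
      obtain rfl : e = j + 1 := by omega
      exact hcon k (hgcd ▸ Nat.gcd_dvd_right _ _)
    obtain ⟨i, hi0, hi⟩ := Nat.exists_mul_modEq (orderSq_ne_zero hp h k)
      (hgcd ▸ pow_dvd_pow l hej : (l ^ (j + 1)).gcd (orderSq p r k) ∣ l ^ j)
    exact ⟨i, hi0, (key i k).2 hi⟩

/-- As `r` has infinite order in the `p`-adic units, its orders modulo `p ^ k` are divisible by
arbitrarily large powers of `p`. -/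
theorem exists_prime_pow_dvd_orderSq {p r : ℕ} (hp : p.Prime) (h : r.Coprime p) (hr : 1 < r)
    (j : ℕ) : ∃ k, p ^ (j + 1) ∣ orderSq p r k := by
  by_contra hcon
  push Not at hcon
  have key : ∀ k, orderSq p r k ∣ (p / 2) * p ^ j := by
    intro k
    obtain ⟨e, d, hd, hde⟩ :=
      Nat.exists_eq_pow_mul_and_not_dvd (orderSq_ne_zero hp h k) p hp.ne_one
    have hej : e ≤ j := by
      by_contra hlt
      exact hcon k (hde ▸ (pow_dvd_pow p (by omega)).mul_right d)
    have h1 : d ∣ p / 2 := by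
      have h2 : d ∣ (p / 2) * p ^ k := (hde ▸ Dvd.intro_left _ rfl).trans (orderSq_dvd hp h k)
      exact (((Nat.Prime.coprime_iff_not_dvd hp).2 hd).pow_left k).symm.dvd_of_dvd_mul_right h2
    rw [hde, mul_comm]
    exact mul_dvd_mul h1 (pow_dvd_pow p hej)
  obtain ⟨E, hE⟩ : ∃ E, E = 2 * ((p / 2) * p ^ j) := ⟨_, rfl⟩
  have hE0 : E ≠ 0 := by
    have := hp.two_le
    have h1 : p / 2 ≠ 0 := by omega
    rw [hE]
    exact mul_ne_zero two_ne_zero (mul_ne_zero h1 (pow_ne_zero _ hp.ne_zero))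
  have h1 := (orderSq_dvd_iff h _).1 (key (r ^ E))
  rw [← hE] at h1
  have h2 : 1 < r ^ E := Nat.one_lt_pow hE0 hr
  have h3 := (Nat.modEq_iff_dvd' h2.le).1 h1.symm
  have h4 := Nat.le_of_dvd (by omega) h3
  have h5 : r ^ E < p ^ (r ^ E) := Nat.lt_pow_self hp.one_lt
  omega

theorem Int.prime_pow_dvd_sub_or_of_dvd_sq_sub_sq {p : ℕ} (hp : p.Prime) {a b : ℤ}
    (hb : ¬ (p : ℤ) ∣ b) {m : ℕ} (h : (p : ℤ) ^ (m + 1) ∣ a ^ 2 - b ^ 2) :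
    (p : ℤ) ^ m ∣ a - b ∨ (p : ℤ) ^ m ∣ -a - b := by
  have hle : (p : ℤ) ^ m ∣ (p : ℤ) ^ (m + 1) := pow_dvd_pow _ m.le_succ
  have hneg : ∀ {c : ℤ}, c ∣ a + b → c ∣ -a - b := fun {c} hc => by
    rwa [← dvd_neg, show -(-a - b) = a + b by ring]
  rw [sq_sub_sq] at h
  by_cases h1 : (p : ℤ) ∣ a - b
  · by_cases h2 : (p : ℤ) ∣ a + b
    · have h3 : (p : ℤ) ∣ 2 * b := by
        have := dvd_sub h2 h1
        rwa [show a + b - (a - b) = 2 * b by ring] at this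
      obtain rfl : p = 2 := by
        have h4 := ((Nat.prime_iff_prime_int.1 hp).dvd_or_dvd h3).resolve_right hb
        exact (Nat.prime_dvd_prime_iff_eq hp Nat.prime_two).1 (by exact_mod_cast h4)
      -- Here `a - b` and `a + b` are even, and their halves are not both even.
      obtain ⟨u, hu⟩ := h1
      obtain ⟨v, hv⟩ := h2
      push_cast at hu hv hb h ⊢
      rcases m with _ | m
      · simp
      have h4 : (2 : ℤ) ^ m ∣ v * u := by
        rw [hu, hv] at h
        have h5 : (2 : ℤ) ^ (m + 1 + 1) = 4 * 2 ^ m := by ring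
        rw [h5, show 2 * v * (2 * u) = 4 * (v * u) by ring] at h
        exact (mul_dvd_mul_iff_left (by norm_num)).1 h
      by_cases hu2 : (2 : ℤ) ∣ u
      · have hv2 : ¬ (2 : ℤ) ∣ v := by omega
        have h6 := Int.prime_pow_dvd_left Nat.prime_two (k := m) (a := u) (M := v)
          (by rw [mul_comm]; exact_mod_cast h4) (by exact_mod_cast hv2)
        left
        rw [hu, pow_succ']
        exact mul_dvd_mul_left _ (by exact_mod_cast h6)
      · have h6 := Int.prime_pow_dvd_left Nat.prime_two (k := m) (a := v) (M := u)
          (by exact_mod_cast h4) (by exact_mod_cast hu2)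
        right
        apply hneg
        rw [hv, pow_succ']
        exact mul_dvd_mul_left _ (by exact_mod_cast h6)
    · left
      rw [mul_comm] at h
      exact hle.trans (Int.prime_pow_dvd_left hp h h2)
  · right
    exact hneg (hle.trans (Int.prime_pow_dvd_left hp h h1))

/-! ### The induced permutation of the primes is trivial -/

namespace IsGolombMap

variable {H K : ℤ → ℤ} {σ ρ : ℕ → ℕ}

theorem padicPowerLimit (A : IsGolombMap H K σ ρ) (B : IsGolombMap K H ρ σ) {p a b : ℕ}
    (hp : p.Prime) (ha : 1 < a) (hb : ¬ p ∣ b) (h : PadicPowerLimit p a b) :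
    PadicPowerLimit (σ p) (H a).natAbs (H b).natAbs := by
  intro k
  obtain ⟨m, hm⟩ := A.prime_cont p hp b (by exact_mod_cast hb) k
  obtain ⟨j, hj, hab⟩ := h (m + 1)
  obtain ⟨w, hw, hwb⟩ : ∃ w : ℤ, w.natAbs = a ^ j ∧ (p : ℤ) ^ m ∣ w - b := by
    have h1 : (p : ℤ) ^ (m + 1) ∣ ((a : ℤ) ^ j) ^ 2 - (b : ℤ) ^ 2 := by
      have := (Int.natCast_modEq_iff.2 hab).symm.dvd
      push_cast at this
      rwa [mul_comm, pow_mul] at this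
    rcases Int.prime_pow_dvd_sub_or_of_dvd_sq_sub_sq hp (by exact_mod_cast hb) h1 with h2 | h2
    · exact ⟨_, by simp [Int.natAbs_pow], h2⟩
    · exact ⟨_, by simp [Int.natAbs_pow], h2⟩
  obtain ⟨i, hi, hHw⟩ := A.exists_natAbs_map_eq_pow B (x := a) (by simpa using ha) hj (y := w)
    (by simpa using hw)
  refine ⟨i, hi, ?_⟩
  rw [← Int.natCast_modEq_iff]
  apply Int.ModEq.symm
  rw [Int.modEq_iff_dvd]
  have h3 : (((H a).natAbs ^ (2 * i) : ℕ) : ℤ) = H w ^ 2 := by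
    rw [← Int.natAbs_sq (H w), hHw]
    push_cast
    rw [mul_comm, pow_mul]
  rw [h3]
  push_cast
  rw [sq_abs]
  exact (hm w hwb).trans (sub_dvd_pow_sub_pow _ _ 2)

end IsGolombMap

/-- If `r` is a prime and `H` maps `r ^ n` to a power of `σ r` up to sign, the exponent of that
power. -/
def powExponent (H : ℤ → ℤ) (σ : ℕ → ℕ) (r n : ℕ) : ℕ := Nat.log (σ r) (H ((r : ℤ) ^ n)).natAbs

namespace IsGolombMap

variable {H K : ℤ → ℤ} {σ ρ : ℕ → ℕ}

theorem natAbs_map_pow (A : IsGolombMap H K σ ρ) (B : IsGolombMap K H ρ σ) {r : ℕ} (hr : r.Prime)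
    (n : ℕ) : (H ((r : ℤ) ^ n)).natAbs = σ r ^ powExponent H σ r n := by
  obtain ⟨a, ha⟩ := A.exists_natAbs_map_prime_pow B hr (w := (r : ℤ) ^ n) (n := n)
    (by simp [Int.natAbs_pow])
  rw [powExponent, ha, Nat.log_pow (A.prime r hr).one_lt]

theorem powExponent_ne_zero (A : IsGolombMap H K σ ρ) (B : IsGolombMap K H ρ σ) {r : ℕ}
    (hr : r.Prime) {n : ℕ} (hn : n ≠ 0) : powExponent H σ r n ≠ 0 := by
  intro h0
  have h1 := A.one_lt_natAbs_map (x := (r : ℤ) ^ n)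
    (by simpa [Int.natAbs_pow] using Nat.one_lt_pow hn hr.one_lt)
  rw [A.natAbs_map_pow B hr, h0, pow_zero] at h1
  omega

theorem powExponent_dvd (A : IsGolombMap H K σ ρ) (B : IsGolombMap K H ρ σ) {r : ℕ}
    (hr : r.Prime) {m n : ℕ} (hm : m ≠ 0) (hn : n ≠ 0) (h : m ∣ n) :
    powExponent H σ r m ∣ powExponent H σ r n := by
  obtain ⟨c, rfl⟩ := h
  obtain ⟨d, -, hd⟩ := A.exists_natAbs_map_eq_pow B (x := (r : ℤ) ^ m)
    (by simpa [Int.natAbs_pow] using Nat.one_lt_pow hm hr.one_lt) (right_ne_zero_of_mul hn)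
    (y := (r : ℤ) ^ (m * c)) (by simp [Int.natAbs_pow, pow_mul])
  rw [A.natAbs_map_pow B hr, A.natAbs_map_pow B hr, ← pow_mul] at hd
  exact ⟨d, Nat.pow_right_injective (A.prime r hr).two_le hd⟩

theorem powExponent_left_inv (A : IsGolombMap H K σ ρ) (B : IsGolombMap K H ρ σ) {r : ℕ}
    (hr : r.Prime) {n : ℕ} (hn : n ≠ 0) :
    powExponent K ρ (σ r) (powExponent H σ r n) = n := by
  have h1 := A.natAbs_map_pow B hr n
  have h2 := B.natAbs_map_pow A (A.prime r hr) (powExponent H σ r n)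
  have h3 := B.natAbs_map_congr A (A.one_lt_natAbs_map (x := (r : ℤ) ^ n)
    (by simpa [Int.natAbs_pow] using Nat.one_lt_pow hn hr.one_lt))
    (y := ((σ r : ℕ) : ℤ) ^ powExponent H σ r n) (by simpa [Int.natAbs_pow] using h1)
  rw [h2, A.left_inv, A.prime_left_inv r hr] at h3
  exact (Nat.pow_right_injective hr.two_le (by simpa [Int.natAbs_pow] using h3)).symm

theorem powExponent_prime_pow (A : IsGolombMap H K σ ρ) (B : IsGolombMap K H ρ σ) {r l : ℕ}
    (hr : r.Prime) (hl : l.Prime) : (powExponent H σ r l).Prime ∧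
      ∀ j, powExponent H σ r (l ^ j) = powExponent H σ r l ^ j :=
  Nat.divisibility_automorphism (f := powExponent H σ r) (g := powExponent K ρ (σ r))
    (fun _ => A.powExponent_ne_zero B hr) (fun _ => B.powExponent_ne_zero A (A.prime r hr))
    (fun _ => A.powExponent_left_inv B hr)
    (fun n hn => by
      have := B.powExponent_left_inv A (A.prime r hr) hn
      rwa [A.prime_left_inv r hr] at this)
    (fun _ _ => A.powExponent_dvd B hr) (fun _ _ => B.powExponent_dvd A (A.prime r hr)) hl

theorem map_injective (A : IsGolombMap H K σ ρ) {p q : ℕ} (hp : p.Prime) (hq : q.Prime)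
    (h : σ p = σ q) : p = q := by
  rw [← A.prime_left_inv p hp, h, A.prime_left_inv q hq]

theorem exists_pow_dvd_orderSq (A : IsGolombMap H K σ ρ) (B : IsGolombMap K H ρ σ) {p r l : ℕ}
    (hp : p.Prime) (hr : r.Prime) (hrp : r ≠ p) (hl : l.Prime) {j : ℕ}
    (h : ∃ k, l ^ (j + 1) ∣ orderSq p r k) :
    ∃ k, powExponent H σ r l ^ (j + 1) ∣ orderSq (σ p) (σ r) k := by
  have hσ : (σ r).Coprime (σ p) :=
    (Nat.coprime_primes (A.prime r hr) (A.prime p hp)).2 fun h => hrp (A.map_injective hr hp h)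
  obtain ⟨hτ, hpow⟩ := A.powExponent_prime_pow B hr hl
  rw [exists_pow_dvd_orderSq_iff hp ((Nat.coprime_primes hr hp).2 hrp) hl] at h
  rw [exists_pow_dvd_orderSq_iff (A.prime p hp) hσ hτ, ← hpow, ← hpow]
  intro hcon
  apply h
  have hinv : ∀ i, (K (((σ r ^ powExponent H σ r (l ^ i) : ℕ) : ℕ) : ℤ)).natAbs = r ^ l ^ i := by
    intro i
    push_cast
    rw [B.natAbs_map_pow A (A.prime r hr),
      A.powExponent_left_inv B hr (pow_ne_zero _ hl.ne_zero), A.prime_left_inv r hr]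
  have := B.padicPowerLimit A (A.prime p hp)
    (Nat.one_lt_pow (A.powExponent_ne_zero B hr (pow_ne_zero _ hl.ne_zero)) (A.prime r hr).one_lt)
    (fun hd => (Nat.Prime.coprime_iff_not_dvd (A.prime p hp)).1 hσ.symm
      ((A.prime p hp).dvd_of_dvd_pow hd)) hcon
  rwa [hinv, hinv, A.prime_left_inv p hp] at this

/-- The exponents determine the permutation of the primes, because `p` is the only prime all of
whose powers divide orders modulo powers of `p`. -/
theorem powExponent_prime (A : IsGolombMap H K σ ρ) (B : IsGolombMap K H ρ σ) {p r : ℕ}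
    (hp : p.Prime) (hr : r.Prime) (hrp : r ≠ p) : powExponent H σ r p = σ p := by
  have hq := A.prime p hp
  obtain ⟨hτ, -⟩ := A.powExponent_prime_pow B hr hp
  have hσ : (σ r).Coprime (σ p) :=
    (Nat.coprime_primes (A.prime r hr) hq).2 fun h => hrp (A.map_injective hr hp h)
  by_contra hne
  obtain ⟨k, hk⟩ := A.exists_pow_dvd_orderSq B hp hr hrp hp (j := σ p)
    (exists_prime_pow_dvd_orderSq hp ((Nat.coprime_primes hr hp).2 hrp) hr.one_lt _)
  have h1 := hk.trans (orderSq_dvd hq hσ k)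
  have h2 := (((Nat.coprime_primes hτ hq).2 hne).pow (σ p + 1) k).dvd_of_dvd_mul_right h1
  have h3 := Nat.le_of_dvd (by have := hq.two_le; omega) h2
  have h4 : σ p + 1 < powExponent H σ r p ^ (σ p + 1) := Nat.lt_pow_self hτ.one_lt
  omega

/-- The permutation of the primes is compatible with the factorization of `p / 2`, which is
the order of the group of squares modulo `p`, for `p` odd. -/
theorem pow_dvd_half (A : IsGolombMap H K σ ρ) (B : IsGolombMap K H ρ σ) {p l : ℕ}
    (hp : p.Prime) (hl : l.Prime) {j : ℕ} (h : l ^ j ∣ p / 2) : σ l ^ j ∣ σ p / 2 := by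
  rcases j with _ | j
  · simp
  have hp2 := hp.two_le
  have hlp : l < p := by
    have h1 := Nat.le_of_dvd (by omega) ((dvd_pow_self l j.succ_ne_zero).trans h)
    omega
  have hodd : p % 2 = 1 := hp.eq_two_or_odd.resolve_left <| by
    rintro rfl
    have := hl.two_le
    omega
  have : Fact p.Prime := ⟨hp⟩
  -- Choose a large prime `r` that is a primitive root modulo `p`.
  obtain ⟨g, hg⟩ := IsCyclic.exists_ofOrder_eq_natCard (α := (ZMod p)ˣ)
  obtain ⟨r, hrp, hr, hrg⟩ := Nat.forall_exists_prime_gt_and_eq_mod g.isUnit p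
  have hcop : r.Coprime p := (Nat.coprime_primes hr hp).2 (by omega)
  have hord : p / 2 ∣ orderSq p r 1 := by
    have h1 := (orderSq_dvd_iff (k := 1) hcop _).1 dvd_rfl
    rw [pow_one, ← ZMod.natCast_eq_natCast_iff] at h1
    push_cast at h1
    rw [hrg, ← Units.val_pow_eq_pow_val, Units.val_eq_one] at h1
    have h2 := orderOf_dvd_of_pow_eq_one h1
    rw [hg, Nat.card_eq_fintype_card, ZMod.card_units] at h2
    rw [show p - 1 = 2 * (p / 2) by omega] at h2
    exact Nat.dvd_of_mul_dvd_mul_left two_pos h2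
  obtain ⟨k, hk⟩ := A.exists_pow_dvd_orderSq B hp hr (by omega) hl ⟨1, h.trans hord⟩
  rw [A.powExponent_prime B hl hr (by omega)] at hk
  have hσ : (σ r).Coprime (σ p) := (Nat.coprime_primes (A.prime r hr) (A.prime p hp)).2
    fun h => hrp.ne' (A.map_injective hr hp h)
  have hσl : (σ l).Coprime (σ p) := (Nat.coprime_primes (A.prime l hl) (A.prime p hp)).2
    fun h => hlp.ne (A.map_injective hl hp h)
  exact (hσl.pow (j + 1) k).dvd_of_dvd_mul_right (hk.trans (orderSq_dvd (A.prime p hp) hσ k))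

theorem half_eq_one (A : IsGolombMap H K σ ρ) (B : IsGolombMap K H ρ σ) {p : ℕ}
    (hp : p.Prime) (h : p / 2 = 1) : σ p / 2 = 1 := by
  by_contra hne
  obtain ⟨l, hl, hlp⟩ := Nat.exists_prime_and_dvd hne
  have := B.pow_dvd_half A (A.prime p hp) hl (j := 1) (by simpa using hlp)
  rw [A.prime_left_inv p hp, h, pow_one, Nat.dvd_one] at this
  exact (B.prime l hl).ne_one this

theorem half_eq_prime (A : IsGolombMap H K σ ρ) (B : IsGolombMap K H ρ σ) {p l : ℕ}
    (hp : p.Prime) (hl : l.Prime) (h : p / 2 = l) : σ p / 2 = σ l := by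
  apply Nat.dvd_antisymm
  · rw [Nat.dvd_iff_prime_pow_dvd_dvd]
    intro q i hq hqi
    have h1 := B.pow_dvd_half A (A.prime p hp) hq hqi
    rw [A.prime_left_inv p hp, h] at h1
    rcases i with _ | i
    · simp
    have h2 := (Nat.prime_dvd_prime_iff_eq (B.prime q hq) hl).1
      ((dvd_pow_self _ i.succ_ne_zero).trans h1)
    have h3 : i + 1 ≤ 1 := by
      rw [h2] at h1
      exact (Nat.pow_dvd_pow_iff_le_right hl.one_lt).1 (by simpa using h1)
    obtain rfl : i = 0 := by omega
    rw [← h2, B.prime_left_inv q hq]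
    simp
  · simpa using A.pow_dvd_half B hp hl (j := 1) (by simp [h])

theorem map_two (A : IsGolombMap H K σ ρ) (B : IsGolombMap K H ρ σ) : σ 2 = 2 := by
  by_contra hne
  have h2 : σ 2 = 3 := by
    have := A.half_eq_one B Nat.prime_two (by norm_num)
    omega
  have h3 : σ 3 ≠ σ 2 := fun h =>
    absurd (A.map_injective Nat.prime_three Nat.prime_two h) (by norm_num)
  -- Interchanging `2` and `3` forces `5` to `7` and then `11` to `15`, which is not a prime.
  have p5 : Nat.Prime 5 := by norm_num
  have h5 : σ 5 = 7 := by
    have h1 := A.half_eq_prime B p5 Nat.prime_two (by norm_num)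
    have h4 : σ 5 ≠ 6 := fun h => absurd (h ▸ A.prime 5 p5) (by norm_num)
    omega
  have p11 : Nat.Prime 11 := by norm_num
  have h1 := A.half_eq_prime B p11 p5 (by norm_num)
  have h14 : σ 11 ≠ 14 := fun h => absurd (h ▸ A.prime 11 p11) (by norm_num)
  have h15 : σ 11 ≠ 15 := fun h => absurd (h ▸ A.prime 11 p11) (by norm_num)
  omega

/-- The permutation of the primes is the identity, by induction: `σ p / 2` has the same
factorization as `p / 2`, whose prime factors are smaller than `p`. -/
theorem prime_map_eq (A : IsGolombMap H K σ ρ) (B : IsGolombMap K H ρ σ) {p : ℕ} (hp : p.Prime) :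
    σ p = p := by
  induction p using Nat.strong_induction_on with
  | _ p ih =>
    by_cases hp2 : p = 2
    · rw [hp2, A.map_two B]
    have hp2' := hp.two_le
    have hodd := hp.eq_two_or_odd.resolve_left hp2
    have hfix : ∀ l : ℕ, l.Prime → l ∣ p / 2 → σ l = l := fun l hl h =>
      ih l (by have := Nat.le_of_dvd (by omega) h; omega) hl
    have hhalf : σ p / 2 = p / 2 := by
      apply Nat.dvd_antisymm
      · rw [Nat.dvd_iff_prime_pow_dvd_dvd]
        intro q i hq hqi
        rcases i with _ | i
        · simp
        have h1 := B.pow_dvd_half A (A.prime p hp) hq hqi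
        rw [A.prime_left_inv p hp] at h1
        have h2 := hfix _ (B.prime q hq) ((dvd_pow_self _ i.succ_ne_zero).trans h1)
        rw [B.prime_left_inv q hq] at h2
        rwa [← h2] at h1
      · rw [Nat.dvd_iff_prime_pow_dvd_dvd]
        intro q i hq hqi
        rcases i with _ | i
        · simp
        have h1 := A.pow_dvd_half B hp hq hqi
        rwa [hfix q hq ((dvd_pow_self _ i.succ_ne_zero).trans hqi)] at h1
    have hσ2 : σ p ≠ 2 := fun h =>
      hp2 (A.map_injective hp Nat.prime_two (h.trans (A.map_two B).symm))
    have := (A.prime p hp).eq_two_or_odd.resolve_left hσ2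
    omega

/-! ### The map is the identity up to a constant sign -/

theorem eq_or_eq_neg (A : IsGolombMap H K σ ρ) (B : IsGolombMap K H ρ σ) {x : ℤ} (hx : x ≠ 0) :
    H x = x ∨ H x = -x := by
  -- A prime `p` larger than all the numbers involved; it suffices to compare modulo `p`.
  obtain ⟨p, hp1, hp⟩ := Nat.exists_infinite_primes (x.natAbs + (H x).natAbs + 1)
  have hpx : ¬ (p : ℤ) ∣ x := fun h => by
    have := Nat.le_of_dvd (Int.natAbs_pos.2 hx) (Int.natCast_dvd.1 h)
    omega
  obtain ⟨m, hm⟩ := A.prime_cont p hp x hpx 1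
  have hpm : IsCoprime x ((p : ℤ) ^ (m + 1)) :=
    (Int.isCoprime_prime_pow_iff hp m.succ_ne_zero).2 hpx
  obtain ⟨z, -, hz, hzx⟩ := Int.exists_prime_gt_and_dvd_sub
    (pow_ne_zero _ (by exact_mod_cast hp.ne_zero)) hpm 0
  have h1 := hm z ((pow_dvd_pow _ m.le_succ).trans hzx)
  rw [A.prime_map_eq B hp, pow_one] at h1
  have h2 : (p : ℤ) ∣ z - x := (dvd_pow_self _ m.succ_ne_zero).trans hzx
  have h3 := A.natAbs_map_prime B hz
  rw [A.prime_map_eq B hz] at h3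
  rcases Int.natAbs_eq_iff.1 h3 with h | h
  · left
    rw [h] at h1
    have h4 := dvd_sub h2 h1
    rw [sub_sub_sub_cancel_left] at h4
    have := Int.eq_zero_of_abs_lt_dvd h4 (by rw [abs_lt]; omega)
    omega
  · right
    rw [h] at h1
    have h4 := dvd_add h2 h1
    rw [show (z : ℤ) - x + (-z - H x) = -(x + H x) by ring] at h4
    have := Int.eq_zero_of_abs_lt_dvd h4 (by rw [abs_lt]; omega)
    omega

/-- The sign of `H x / x` is `p`-adically locally constant, away from the multiples of an odd
prime `p`. -/
theorem exists_pow_sign_eq (A : IsGolombMap H K σ ρ) (B : IsGolombMap K H ρ σ) {p : ℕ}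
    (hp : p.Prime) (hp2 : p ≠ 2) {x : ℤ} (hx : ¬ (p : ℤ) ∣ x) :
    ∃ m : ℕ, ∀ z : ℤ, z ≠ 0 → (p : ℤ) ^ m ∣ z - x → (H z = z ↔ H x = x) := by
  have hx0 : x ≠ 0 := by rintro rfl; simp at hx
  obtain ⟨m, hm⟩ := A.prime_cont p hp x hx 1
  refine ⟨m + 1, fun z hz0 hz => ?_⟩
  have h1 := hm z ((pow_dvd_pow _ m.le_succ).trans hz)
  rw [A.prime_map_eq B hp, pow_one] at h1
  have h2 : (p : ℤ) ∣ z - x := (dvd_pow_self _ m.succ_ne_zero).trans hz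
  have key : ¬ (p : ℤ) ∣ 2 * x := fun h => by
    rcases (Nat.prime_iff_prime_int.1 hp).dvd_or_dvd h with h | h
    · exact hp2 ((Nat.prime_dvd_prime_iff_eq hp Nat.prime_two).1 (by exact_mod_cast h))
    · exact hx h
  rcases A.eq_or_eq_neg B hz0 with hz1 | hz1 <;> rcases A.eq_or_eq_neg B hx0 with hx1 | hx1
  · exact ⟨fun _ => hx1, fun _ => hz1⟩
  · refine absurd ?_ key
    rw [hz1, hx1] at h1
    have := dvd_sub h1 h2
    rwa [show z - -x - (z - x) = 2 * x by ring] at this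
  · refine absurd ?_ key
    rw [hz1, hx1] at h1
    have := dvd_add h1 h2
    rwa [show -z - x + (z - x) = -(2 * x) by ring, dvd_neg] at this
  · constructor <;> intro h <;> omega

theorem eq_self (A : IsGolombMap H K σ ρ) (B : IsGolombMap K H ρ σ) (h1 : H 1 = 1) {x : ℤ}
    (hx : x ≠ 0) : H x = x := by
  obtain ⟨p, hp, hp2, -, hpx⟩ := Int.exists_odd_prime_not_dvd hx 0
  obtain ⟨q, hq, hq2, hqp, hq1⟩ := Int.exists_odd_prime_not_dvd one_ne_zero p
  obtain ⟨m, hm⟩ := A.exists_pow_sign_eq B hp hp2 hpx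
  obtain ⟨l, hl⟩ := A.exists_pow_sign_eq B hq hq2 hq1
  obtain ⟨z, hz1, hz2⟩ := Int.exists_dvd_sub_and_dvd_sub
    (a := (p : ℤ) ^ (m + 1)) (b := (q : ℤ) ^ (l + 1))
    (Nat.isCoprime_iff_coprime.2 ((Nat.coprime_primes hp hq).2 hqp.symm)).pow x 1
  have hz0 : z ≠ 0 := by
    rintro rfl
    exact hpx (by simpa using (dvd_pow_self (p : ℤ) m.succ_ne_zero).trans hz1)
  rw [← hm z hz0 ((pow_dvd_pow _ m.le_succ).trans hz1),
    hl z hz0 ((pow_dvd_pow _ l.le_succ).trans hz2), h1]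

end IsGolombMap

/-! ### From homeomorphisms to arithmetic -/

namespace GolombSpace

/-- The point of the Golomb space given by a nonzero integer; the junk value at `0` is `1`. -/
def ofInt (n : ℤ) : GolombSpace ℤ := if h : n = 0 then ⟨1, one_ne_zero⟩ else ⟨n, h⟩

theorem ofInt_val {n : ℤ} (h : n ≠ 0) : (ofInt n).val = n := by simp [ofInt, h]

theorem ofInt_self (x : GolombSpace ℤ) : ofInt x.val = x := ext_val (ofInt_val x.ne_zero)

/-- The extension by `0 ↦ 0` of a self-map of the Golomb space of `ℤ` to a self-map of `ℤ`. -/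
def extendZero (h : GolombSpace ℤ → GolombSpace ℤ) (n : ℤ) : ℤ :=
  if n = 0 then 0 else (h (ofInt n)).val

theorem extendZero_zero (h : GolombSpace ℤ → GolombSpace ℤ) : extendZero h 0 = 0 := by
  simp [extendZero]

theorem extendZero_val (h : GolombSpace ℤ → GolombSpace ℤ) (x : GolombSpace ℤ) :
    extendZero h x.val = (h x).val := by
  simp [extendZero, x.ne_zero, ofInt_self]

/-- The permutation of the prime numbers induced by a homeomorphism `h`: the image of the point `p`
is divisible by one prime only (see `prime_dvd_map_prime_iff`). -/
def primeMap (h : GolombSpace ℤ → GolombSpace ℤ) (p : ℕ) : ℕ := (extendZero h p).natAbs.minFac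

theorem forall_prime_not_dvd_iff (x : GolombSpace ℤ) :
    (∀ p : ℕ, p.Prime → ¬ (p : ℤ) ∣ x.val) ↔ x.val = 1 ∨ x.val = -1 := by
  rw [show x.val = 1 ∨ x.val = -1 ↔ x.val.natAbs = 1 by omega]
  constructor
  · intro h
    by_contra hne
    obtain ⟨p, hp, hpx⟩ := Nat.exists_prime_and_dvd hne
    exact h p hp (Int.natCast_dvd.2 hpx)
  · intro h p hp hpx
    rw [Int.natCast_dvd, h, Nat.dvd_one] at hpx
    exact hp.ne_one hpx

instance : One (GolombSpace ℤ) := ⟨⟨1, one_ne_zero⟩⟩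

instance : Neg (GolombSpace ℤ) := ⟨fun x => ⟨-x.val, neg_ne_zero.2 x.ne_zero⟩⟩

@[simp] theorem val_one : (1 : GolombSpace ℤ).val = 1 := rfl

@[simp] theorem val_neg (x : GolombSpace ℤ) : (-x).val = -x.val := rfl

theorem continuous_neg : Continuous (fun x : GolombSpace ℤ => -x) := by
  refine continuous_def.2 fun U hU => isOpen_iff.2 fun x hx => ?_
  obtain ⟨N, hN, hxN, hNU⟩ := isOpen_iff.1 hU _ hx
  refine ⟨N, hN, by simpa using hxN.neg_left, fun z hz => hNU ?_⟩
  have := (dvd_neg (a := N)).2 (show N ∣ z.val - x.val from hz)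
  simpa [residueClass, neg_add_eq_sub] using this

/-- The homeomorphism `x ↦ -x` of the Golomb space of `ℤ`. -/
def negHomeomorph : GolombSpace ℤ ≃ₜ GolombSpace ℤ where
  toFun x := -x
  invFun x := -x
  left_inv x := ext_val (by simp)
  right_inv x := ext_val (by simp)
  continuous_toFun := continuous_neg
  continuous_invFun := continuous_neg

/-- The pair `(1, -1)` is closure-finer than all the other pairs, and only the pairs of units have
this property; so a homeomorphism preserves the units. -/
theorem map_one_eq (h : GolombSpace ℤ ≃ₜ GolombSpace ℤ) : h 1 = 1 ∨ h 1 = -1 := by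
  have hne : (1 : GolombSpace ℤ) ≠ -1 := fun h => by
    have := congrArg GolombSpace.val h
    simp at this
  have h1 : ∀ x y : GolombSpace ℤ, ClosureFiner x y (-1) 1 := fun x y =>
    closureFiner_of_dvd (by simp) hne.symm fun p hp hd =>
      absurd hd ((forall_prime_not_dvd_iff 1).2 (Or.inl rfl) p hp)
  have h2 : ClosureFiner 1 (-1) (h (-1)) (h 1) := by
    have := (h1 (h.symm 1) (h.symm (-1))).map h
    simpa using this
  have h3 := (forall_prime_not_dvd_iff (h 1)).1 fun p hp =>
    ClosureFiner.not_dvd_right hne h2 hp ((forall_prime_not_dvd_iff _).2 (Or.inl rfl) p hp)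
      ((forall_prime_not_dvd_iff (-1)).2 (Or.inr rfl) p hp)
  exact h3.imp (fun h => ext_val h) (fun h => ext_val h)

theorem closureFiner_one_iff {x y : GolombSpace ℤ} (hx : x ≠ 1) (hy : y ≠ 1) :
    ClosureFiner 1 x 1 y ↔ ∀ p : ℕ, p.Prime → (p : ℤ) ∣ y.val → (p : ℤ) ∣ x.val := by
  constructor
  · intro H p hp hpy
    by_contra hpx
    exact ClosureFiner.not_dvd_right hx.symm H hp
      ((forall_prime_not_dvd_iff 1).2 (Or.inl rfl) p hp) hpx hpy
  · exact fun H => closureFiner_of_dvd (by simp) hy.symm fun p hp h => ⟨H p hp h, rfl⟩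

section

variable {h : GolombSpace ℤ ≃ₜ GolombSpace ℤ}

theorem prime_dvd_imp_map_iff (h1 : h 1 = 1) {x y : GolombSpace ℤ} (hx : x ≠ 1) (hy : y ≠ 1) :
    (∀ p : ℕ, p.Prime → (p : ℤ) ∣ (h y).val → (p : ℤ) ∣ (h x).val) ↔
      ∀ p : ℕ, p.Prime → (p : ℤ) ∣ y.val → (p : ℤ) ∣ x.val := by
  have hne : ∀ z, z ≠ 1 → h z ≠ 1 := fun z hz hz1 => hz (h.injective (hz1.trans h1.symm))
  rw [← closureFiner_one_iff hx hy, ← closureFiner_one_iff (hne x hx) (hne y hy)]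
  conv_rhs => rw [← closureFiner_map_iff h, h1]

theorem symm_one (h1 : h 1 = 1) : h.symm 1 = 1 := by rw [h.symm_apply_eq, h1]

theorem ne_one_of_prime_dvd {p : ℕ} (hp : p.Prime) {x : GolombSpace ℤ} (h : (p : ℤ) ∣ x.val) :
    x ≠ 1 := by
  rintro rfl
  exact (forall_prime_not_dvd_iff 1).2 (Or.inl rfl) p hp h

/-- A point divisible by a prime is mapped to such a point: otherwise its prime divisors would all
divide `-1`, as the inclusion of sets of prime divisors is reflected by `h`. -/
theorem exists_prime_dvd_map (h1 : h 1 = 1) {p : ℕ} (hp : p.Prime) {x : GolombSpace ℤ}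
    (hpx : (p : ℤ) ∣ x.val) : ∃ q : ℕ, q.Prime ∧ (q : ℤ) ∣ (h x).val := by
  by_contra hcon
  push Not at hcon
  have hne : (-1 : GolombSpace ℤ) ≠ 1 := fun h => by
    have := congrArg GolombSpace.val h
    simp at this
  refine (forall_prime_not_dvd_iff (-1)).2 (Or.inr rfl) p hp ?_
  exact (prime_dvd_imp_map_iff h1 hne (ne_one_of_prime_dvd hp hpx)).1
    (fun q hq hqx => absurd hqx (hcon q hq)) p hp hpx

/-- The image of the point `p` is divisible by one prime only, the prime `primeMap h p`. -/
theorem prime_dvd_map_prime_iff (h1 : h 1 = 1) {p : ℕ} (hp : p.Prime) :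
    (primeMap h p).Prime ∧ ∀ q : ℕ, q.Prime → ((q : ℤ) ∣ (h (ofInt p)).val ↔ q = primeMap h p) := by
  have hpv : (ofInt p).val = p := ofInt_val (by exact_mod_cast hp.ne_zero)
  have hp1 : ofInt p ≠ 1 := ne_one_of_prime_dvd hp (dvd_of_eq hpv.symm)
  -- If `q` divides `h p`, then the prime divisors of the preimage of `q` are those of `p`.
  have key : ∀ q : ℕ, q.Prime → (q : ℤ) ∣ (h (ofInt p)).val →
      ∀ r : ℕ, r.Prime → (r : ℤ) ∣ (h (ofInt p)).val → r = q := by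
    intro q hq hqd r hr hrd
    have hqv : (ofInt q).val = q := ofInt_val (by exact_mod_cast hq.ne_zero)
    have hq1 : ofInt q ≠ 1 := ne_one_of_prime_dvd hq (dvd_of_eq hqv.symm)
    have hsq1 : h.symm (ofInt q) ≠ 1 := fun h' => hq1 (by rw [← h1, ← h', h.apply_symm_apply])
    have hsub := (prime_dvd_imp_map_iff h1 hp1 hsq1).1 (fun s hs hsd => by
      rw [h.apply_symm_apply, hqv] at hsd
      rwa [(Nat.prime_dvd_prime_iff_eq hs hq).1 (by exact_mod_cast hsd)])
    obtain ⟨s, hs, hsd⟩ := exists_prime_dvd_map (h := h.symm) (symm_one h1) hq (dvd_of_eq hqv.symm)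
    have hsp : s = p := by
      have := hsub s hs hsd
      rw [hpv] at this
      exact (Nat.prime_dvd_prime_iff_eq hs hp).1 (by exact_mod_cast this)
    have hsup := (prime_dvd_imp_map_iff h1 hsq1 hp1).2 (fun t ht htd => by
      rw [hpv] at htd
      rw [(Nat.prime_dvd_prime_iff_eq ht hp).1 (by exact_mod_cast htd), ← hsp]
      exact hsd) r hr hrd
    rw [h.apply_symm_apply, hqv] at hsup
    exact (Nat.prime_dvd_prime_iff_eq hr hq).1 (by exact_mod_cast hsup)
  obtain ⟨q, hq, hqd⟩ := exists_prime_dvd_map h1 hp (x := ofInt p) (dvd_of_eq hpv.symm)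
  have hval : extendZero h p = (h (ofInt p)).val := by
    rw [← hpv, extendZero_val, hpv]
  have hmin : primeMap h p = q := by
    have hne : (h (ofInt p)).val.natAbs ≠ 1 := fun h' =>
      hq.ne_one (Nat.dvd_one.1 (h' ▸ Int.natCast_dvd.1 hqd))
    rw [primeMap, hval]
    exact key q hq hqd _ (Nat.minFac_prime hne) (Int.natCast_dvd.2 (Nat.minFac_dvd _))
  rw [hmin]
  exact ⟨hq, fun r hr => ⟨key q hq hqd r hr, fun h => h ▸ hqd⟩⟩

theorem primeMap_dvd_iff (h1 : h 1 = 1) {p : ℕ} (hp : p.Prime) (x : GolombSpace ℤ) :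
    ((primeMap h p : ℕ) : ℤ) ∣ (h x).val ↔ (p : ℤ) ∣ x.val := by
  obtain ⟨hq, hiff⟩ := prime_dvd_map_prime_iff h1 hp
  have hpv : (ofInt p).val = p := ofInt_val (by exact_mod_cast hp.ne_zero)
  have hp1 : ofInt p ≠ 1 := ne_one_of_prime_dvd hp (dvd_of_eq hpv.symm)
  by_cases hx : x = 1
  · subst hx
    rw [h1]
    have hu := (forall_prime_not_dvd_iff 1).2 (Or.inl rfl)
    exact iff_of_false (hu _ hq) (hu _ hp)
  have := prime_dvd_imp_map_iff h1 hx hp1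
  constructor
  · intro hd
    refine this.1 (fun r hr hrd => ?_) p hp (dvd_of_eq hpv.symm)
    rwa [(hiff r hr).1 hrd]
  · intro hd
    refine this.2 (fun r hr hrd => ?_) _ hq ((hiff _ hq).2 rfl)
    rw [hpv] at hrd
    rwa [(Nat.prime_dvd_prime_iff_eq hr hp).1 (by exact_mod_cast hrd)]

theorem primeMap_symm_primeMap (h1 : h 1 = 1) {p : ℕ} (hp : p.Prime) :
    primeMap h.symm (primeMap h p) = p := by
  obtain ⟨hq, hiff⟩ := prime_dvd_map_prime_iff h1 hp
  have hpv : (ofInt p).val = p := ofInt_val (by exact_mod_cast hp.ne_zero)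
  obtain ⟨hr, -⟩ := prime_dvd_map_prime_iff (symm_one h1) hq
  have h2 := (primeMap_dvd_iff (symm_one h1) hq (h (ofInt p))).2 ((hiff _ hq).2 rfl)
  rw [h.symm_apply_apply, hpv] at h2
  exact (Nat.prime_dvd_prime_iff_eq hr hp).1 (by exact_mod_cast h2)

theorem exists_residueClass_map (x : GolombSpace ℤ) {N : ℤ} (hN : N ≠ 0)
    (hcop : IsCoprime (h x).val N) : ∃ M : ℤ, M ≠ 0 ∧ IsCoprime x.val M ∧
      ∀ z : GolombSpace ℤ, M ∣ z.val - x.val → N ∣ (h z).val - (h x).val := by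
  obtain ⟨M, hM, hxM, hsub⟩ := isOpen_iff.1 ((isOpen_residueClass hN hcop).preimage h.continuous) x
    (self_mem_residueClass (h x) N)
  exact ⟨M, hM, hxM, fun z hz => hsub hz⟩

/-- A homeomorphism is continuous from the `p`-adic to the `primeMap h p`-adic topology, away from
the multiples of `p`, because these topologies are generated by the traces of closed-open sets. -/
theorem exists_prime_pow_map (h1 : h 1 = 1) {p : ℕ} (hp : p.Prime) {x : GolombSpace ℤ}
    (hx : ¬ (p : ℤ) ∣ x.val) (k : ℕ) : ∃ m : ℕ, m ≠ 0 ∧ ∀ z : GolombSpace ℤ,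
      (p : ℤ) ^ m ∣ z.val - x.val →
        ((primeMap h p : ℕ) : ℤ) ^ (k + 1) ∣ (h z).val - (h x).val := by
  have hq := (prime_dvd_map_prime_iff h1 hp).1
  have hdvd := primeMap_dvd_iff h1 hp
  generalize primeMap h p = q at hq hdvd ⊢
  have hqk : (q : ℤ) ^ (k + 1) ≠ 0 := pow_ne_zero _ (by exact_mod_cast hq.ne_zero)
  have hcop : ∀ z : GolombSpace ℤ, ¬ (q : ℤ) ∣ z.val → IsCoprime z.val ((q : ℤ) ^ (k + 1)) :=
    fun z hz => (Int.isCoprime_prime_pow_iff hq k.succ_ne_zero).2 hz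
  have hhx : ¬ (q : ℤ) ∣ (h x).val := fun h' => hx ((hdvd x).1 h')
  have hC := isOpen_residueClass hqk (hcop _ hhx)
  have hD : IsOpen {z : GolombSpace ℤ | ¬ (q : ℤ) ∣ z.val ∧
      ¬ (q : ℤ) ^ (k + 1) ∣ z.val - (h x).val} := by
    refine isOpen_iff.2 fun z hz => ⟨_, hqk, hcop z hz.1, fun w hw => ⟨fun h' => hz.1 ?_,
      fun h' => hz.2 ?_⟩⟩
    · have := dvd_sub h' ((dvd_pow_self _ k.succ_ne_zero).trans
        (show (q : ℤ) ^ (k + 1) ∣ w.val - z.val from hw))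
      simpa using this
    · have := dvd_sub h' (show (q : ℤ) ^ (k + 1) ∣ w.val - z.val from hw)
      simpa using this
  obtain ⟨m, hm0, hm⟩ := exists_pow_residueClass_subset hp (hC.preimage h.continuous)
    (hD.preimage h.continuous)
    (Set.disjoint_left.2 fun z hz1 hz2 => hz2.2 hz1)
    (fun z hz => by
      by_cases hd : (q : ℤ) ^ (k + 1) ∣ (h z).val - (h x).val
      · exact Or.inl hd
      · exact Or.inr ⟨fun h' => hz ((hdvd z).1 h'), hd⟩)
    hx (self_mem_residueClass (h x) _)
  exact ⟨m, hm0, fun z hz => hm hz⟩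

theorem isGolombMap (h1 : h 1 = 1) :
    IsGolombMap (extendZero h) (extendZero h.symm) (primeMap h) (primeMap h.symm) where
  left_inv x := by
    by_cases hx : x = 0
    · rw [hx, extendZero_zero, extendZero_zero]
    · rw [← ofInt_val hx, extendZero_val, extendZero_val, h.symm_apply_apply]
  prime p hp := (prime_dvd_map_prime_iff h1 hp).1
  prime_left_inv p hp := primeMap_symm_primeMap h1 hp
  dvd_iff p hp x := by
    by_cases hx : x = 0
    · simp [hx, extendZero_zero]
    · rw [← ofInt_val hx, extendZero_val, primeMap_dvd_iff h1 hp]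
  cont x N hx hN hcop := by
    rw [← ofInt_val hx, extendZero_val] at hcop ⊢
    obtain ⟨M, hM, hxM, hMN⟩ := exists_residueClass_map (ofInt x) hN hcop
    -- Multiplying the modulus by a prime that does not divide `x` excludes `z = 0`.
    obtain ⟨q, hq, -, -, hqx⟩ := Int.exists_odd_prime_not_dvd (ofInt x).ne_zero 0
    refine ⟨M * q, mul_ne_zero hM (by exact_mod_cast hq.ne_zero), hxM.mul_right
      ((Nat.prime_iff_prime_int.1 hq).coprime_iff_not_dvd.2 hqx).symm, fun z hz => ?_⟩
    have hz0 : z ≠ 0 := by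
      rintro rfl
      exact hqx (by simpa using (dvd_mul_left (q : ℤ) M).trans hz)
    rw [← ofInt_val hz0] at hz ⊢
    rw [extendZero_val]
    exact hMN _ ((dvd_mul_right M _).trans hz)
  prime_cont p hp x hx k := by
    have hx0 : x ≠ 0 := by rintro rfl; simp at hx
    rw [← ofInt_val hx0] at hx ⊢
    obtain ⟨m, hm0, hm⟩ := exists_prime_pow_map h1 hp hx k
    refine ⟨m, fun z hz => ?_⟩
    have hz0 : z ≠ 0 := by
      rintro rfl
      refine hx ((dvd_pow_self (p : ℤ) hm0).trans ?_)
      simpa using hz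
    rw [← ofInt_val hz0] at hz ⊢
    rw [extendZero_val, extendZero_val]
    exact (pow_dvd_pow _ k.le_succ).trans (hm _ hz)

end

end GolombSpace

theorem mainTheorem1 (h : GolombSpace ℤ → GolombSpace ℤ) :
    IsHomeomorph h ↔
      (∀ x : GolombSpace ℤ, (h x).val = x.val) ∨
      (∀ x : GolombSpace ℤ, (h x).val = -1 * x.val) := by
  open GolombSpace in
  constructor
  · intro hh
    have key : ∀ e : GolombSpace ℤ ≃ₜ GolombSpace ℤ, e 1 = 1 → ∀ x, (e x).val = x.val := by
      intro e he x
      have h1 : extendZero e 1 = 1 := by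
        have := extendZero_val e 1
        rwa [he] at this
      rw [← extendZero_val]
      exact (isGolombMap he).eq_self (isGolombMap (symm_one he)) h1 x.ne_zero
    rcases map_one_eq (hh.homeomorph h) with h1 | h1
    · exact Or.inl (key _ h1)
    · right
      intro x
      have := key ((hh.homeomorph h).trans negHomeomorph)
        (ext_val (by simp [negHomeomorph, h1])) x
      have h2 : -(h x).val = x.val := this
      rw [← h2]
      ring
  · rintro (hh | hh)
    · obtain rfl : h = id := funext fun x => ext_val (hh x)
      exact IsHomeomorph.id
    · obtain rfl : h = negHomeomorph := funext fun x => ext_val (by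
        rw [hh, neg_one_mul]
        rfl)
      exact negHomeomorph.isHomeomorph
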